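/- Let $A$ be a non-empty finite set of positive integers, and put $m(a)=3a+1$ and $\ell(a)=2a+1$ for $a\in A$. Let $K(a)$ be the polygonal curve from $0$ to $1$ in the plane made of $m(a)$ segments of length $\ell(a)^{-1}$, obtained from $[0,1]$ by dividing it into $\ell(a)$ equal intervals and replacing the 2nd, 4th, ..., $2a$-th of them by the two other sides of the equilateral triangle erected on it, on the left of the direction of travel. For a sequence $x=(x_n)_{n\ge1}$ in $A$ let $K(x)$ be the limit of the curves obtained from $[0,1]$ by replacing, at step $n$, every segment by a scaled copy of $K(x_n)$ (directed and oriented consistently), and let $D(x)$ be the domain enclosed by the Jordan curve made of three copies of $K(x)$ placed on the sides of an equilateral triangle of side $1$ with the spikes pointing outwards. Let $(\xi_n)_{n\ge1}$ be a stationary and ergodic sequence of $A$-valued random variables, and let $D=D(\xi)$. Then there is a probability distribution $(p_a)_{a\in A}$ such that, almost surely, $\frac1n\#\{i\le n:\xi_i=a\}\to p_a$ as $n\to\infty$ for every $a\in A$, and the Minkowski dimension of $\partial D$ exists, is equal to the Hausdorff dimension of $\partial D$, and is given by $$\frac{\sum_{a\in A}p_a\log m(a)}{\sum_{a\in A}p_a\log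 \ell(a)}.$$ Here the Minkowski dimension of $\partial D$ is understood both as the inner one, i.e. $2-\lim_{\epsilon\to0+}\log\mu(\epsilon)/\log\epsilon$ with $\mu(\epsilon)$ the area of $\{x\in D: d(x,\partial D)\le\epsilon\}$, and as the usual one, where $\mu(\epsilon)$ is replaced by the area of $\{x\in\mathbb R^2: d(x,\partial D)\le\epsilon\}$; both exist and have the value above. -/

import Mathlib

open MeasureTheory Filter Topology Set

noncomputable section

namespace Snowflake

/-- Number of segments of the building block with `a` spikes. -/
def m (a : ℕ) : ℕ := 3 * a + 1

/-- Inverse of the length of each segment of the building block with `a` spikes. -/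
def ell (a : ℕ) : ℕ := 2 * a + 1

/-- Direction of the `j`-th segment (`0 ≤ j < m a`) of a building block: the segments are, in order,
flat, up, down, flat, up, down, …, flat; each pair "up, down" is an equilateral spike on the left
of the direction of travel. -/
def dir (j : ℕ) : ℂ :=
  if j % 3 = 0 then 1
  else if j % 3 = 1 then Complex.exp ((Real.pi / 3 : ℝ) * Complex.I)
  else Complex.exp (-(Real.pi / 3 : ℝ) * Complex.I)

/-- The `k`-th vertex (`0 ≤ k ≤ m a`) of the building block with `a` spikes, which runs from `0` to
`1` in the plane `ℂ`. -/
def vertex (a k : ℕ) : ℂ := (∑ j ∈ Finset.range k, dir j) / (ell a : ℂ)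

/-- The orientation preserving similarity of ratio `1 / ell a` that carries `[0,1]` to the `j`-th
segment of the building block with `a` spikes. -/
def sim (a j : ℕ) (z : ℂ) : ℂ := vertex a j + dir j / (ell a : ℂ) * z

/-- The `n`-th iteration of the construction: start with `[0,1]` and use the building block with
`x i` spikes at the `i`-th step (`i = 0, …, n - 1`). -/
def polygon : ℕ → (ℕ → ℕ) → Set ℂ
  | 0, _ => segment ℝ (0 : ℂ) 1
  | n + 1, x => ⋃ j ∈ Finset.range (m (x 0)), sim (x 0) j '' polygon n (fun i => x (i + 1))

/-- The limiting Koch-type curve, as a subset of the plane: the limit of the sets `polygon n x`. -/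
def curve (x : ℕ → ℕ) : Set ℂ :=
  {z | Tendsto (fun n => Metric.infDist z (polygon n x)) atTop (𝓝 0)}

/-- The third vertex of the equilateral triangle below `[0,1]`. -/
def apex : ℂ := Complex.exp (-(Real.pi / 3 : ℝ) * Complex.I)

/-- The closed curve made of three copies of `curve x`, placed on the sides
`0 → 1 → apex → 0` (clockwise, so with spikes pointing outwards) of an equilateral triangle. -/
def closedCurve (x : ℕ → ℕ) : Set ℂ :=
  curve x ∪ (fun z => 1 + (apex - 1) * z) '' curve x ∪ (fun z => apex + (0 - apex) * z) '' curve x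

/-- The domain enclosed by `closedCurve x`: the points off the curve whose connected component in
the complement of the curve is bounded. -/
def domain (x : ℕ → ℕ) : Set ℂ :=
  {z | z ∉ closedCurve x ∧ Bornology.IsBounded (connectedComponentIn (closedCurve x)ᶜ z)}

/-- Volume of the inner `ε`-tubular neighbourhood of the boundary of a planar domain. -/
def innerVol (D : Set ℂ) (ε : ℝ) : ENNReal := volume (Metric.cthickening ε (frontier D) ∩ D)

/-- `log V(ε) / log ε`, with `log 0 = -∞` and `log ∞ = ∞`. -/
def logRatio (V : ℝ → ENNReal) (ε : ℝ) : EReal := ENNReal.log (V ε) / ((Real.log ε : ℝ) : EReal)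

/-- `2 - limsup_{ε → 0+} log V(ε) / log ε`. -/
def lowerDim (V : ℝ → ENNReal) : EReal := 2 - limsup (logRatio V) (𝓝[>] 0)

/-- `2 - liminf_{ε → 0+} log V(ε) / log ε`. -/
def upperDim (V : ℝ → ENNReal) : EReal := 2 - liminf (logRatio V) (𝓝[>] 0)

/-- The inner Minkowski dimension of the boundary of `D` exists and equals `s`. -/
def HasInnerMinkowskiDim (D : Set ℂ) (s : ℝ) : Prop :=
  lowerDim (innerVol D) = (s : EReal) ∧ upperDim (innerVol D) = (s : EReal)

/-- The usual (two-sided) Minkowski dimension of the planar set `K` exists and equals `s`. -/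
def HasMinkowskiDim (K : Set ℂ) (s : ℝ) : Prop :=
  lowerDim (fun ε => volume (Metric.cthickening ε K)) = (s : EReal) ∧
    upperDim (fun ε => volume (Metric.cthickening ε K)) = (s : EReal)

/-- Proportion of the first `n` terms of `x` that equal `a`. -/
def freq (x : ℕ → ℕ) (a n : ℕ) : ℝ :=
  (1 / (n : ℝ)) * ∑ i ∈ Finset.range n, if x i = a then (1 : ℝ) else 0

/-- A sequence of random variables is stationary and ergodic: the left shift preserves the law of
the whole sequence and is ergodic for it. -/
def StationaryErgodic {Ω : Type*} [MeasurableSpace Ω] (P : Measure Ω) (ξ : ℕ → Ω → ℕ) : Prop :=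
  Ergodic (fun (x : ℕ → ℕ) (n : ℕ) => x (n + 1)) (P.map (fun ω n => ξ n ω))

/-- The ratio of the `p`-averages over `A` of `log m` and `log ell`. -/
def dimValue (A : Finset ℕ) (p : ℕ → ℝ) : ℝ :=
  (∑ a ∈ A, p a * Real.log (m a)) / ∑ a ∈ A, p a * Real.log (ell a)

end Snowflake

end

/-! Chance enters only through frequencies. The law of `ξ` is ergodic under the shift, so Birkhoff's
theorem for the indicator of `x 0 = a` gives almost surely the limit frequency `p a = P(ξ 0 = a)`.
The rest is deterministic. After `n` steps there are `count n x` segments of length `1 / scale n x`,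
and convergent frequencies force `count = scale ^ (s + o(1))`, with `s` the claimed quotient
(`hasGrowth_of_freq`). Each step multiplies `scale` by a bounded factor, so every small `ε` is
comparable to some `1 / scale n x`.

Upper bounds: the closed curve is covered by `3 * count` balls of radius `1 / scale`
(`exists_cover_closedCurve`), which bounds the area of tubular neighbourhoods and the Hausdorff
measures.

Lower bounds rest on an open set condition: the similarities map the open rhombus over `[0,1]` into
itself with disjoint images (`sim_image_rhombus`, `sim_rhombus_disjoint`). The lower halves of the
small rhombi lie, up to a null set, inside the domain and within `1 / scale` of its boundary, so the
inner area is at least a constant times `count / scale ^ 2` (`le_innerVol`). The measure giving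
equal mass to all segments of a level has mass at most a constant times `r ^ 2 * scale ^ 2 / count`
on balls of radius `r ≥ 1 / scale` (`exists_measure`), and the mass distribution principle bounds
the Hausdorff dimension from below.

The Jordan curve theorem is not used. It suffices that `curve x ⊆ frontier (domain x) ⊆ closedCurve
x`. The second inclusion is formal; the first holds because the triangle with all its spikes
(`filled`), minus the curve, consists of enclosed points (`filled_diff_subset_domain`). -/

/-! ### Birkhoff's ergodic theorem for bounded functions -/

section Birkhoff

variable {X : Type*} {T : X → X} {f : X → ℝ}

/-- The maximum of the Birkhoff sums of `f` of length at most `n`. -/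
def maxBirkhoffSum (T : X → X) (f : X → ℝ) : ℕ → X → ℝ
  | 0, _ => 0
  | n + 1, x => max 0 (f x + maxBirkhoffSum T f n (T x))

theorem maxBirkhoffSum_nonneg (T : X → X) (f : X → ℝ) (n : ℕ) (x : X) :
    0 ≤ maxBirkhoffSum T f n x := by
  cases n with
  | zero => exact le_rfl
  | succ n => exact le_max_left _ _

theorem maxBirkhoffSum_le_succ (T : X → X) (f : X → ℝ) (n : ℕ) :
    ∀ x, maxBirkhoffSum T f n x ≤ maxBirkhoffSum T f (n + 1) x := by
  induction n with
  | zero => exact fun x => maxBirkhoffSum_nonneg T f 1 x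
  | succ n ih => exact fun x => max_le_max le_rfl (by linarith [ih (T x)])

theorem birkhoffSum_le_maxBirkhoffSum (T : X → X) (f : X → ℝ) (n : ℕ) :
    ∀ x, birkhoffSum T f n x ≤ maxBirkhoffSum T f n x := by
  induction n with
  | zero => intro x; simp [maxBirkhoffSum]
  | succ n ih =>
    intro x
    rw [birkhoffSum_succ']
    exact le_max_of_le_right (by linarith [ih (T x)])

theorem maxBirkhoffSum_le (T : X → X) {C : ℝ} (hC : ∀ x, |f x| ≤ C) (n : ℕ) :
    ∀ x, maxBirkhoffSum T f n x ≤ n * C := by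
  induction n with
  | zero => intro x; simp [maxBirkhoffSum]
  | succ n ih =>
    intro x
    have h0 := (abs_nonneg _).trans (hC x)
    have h1 := (le_abs_self _).trans (hC x)
    refine max_le (by positivity) ?_
    push_cast
    linarith [ih (T x)]

variable [MeasurableSpace X] {μ : Measure X}

theorem measurable_maxBirkhoffSum (hT : Measurable T) (hf : Measurable f) (n : ℕ) :
    Measurable (maxBirkhoffSum T f n) := by
  induction n with
  | zero => exact measurable_const
  | succ n ih => exact measurable_const.max (hf.add (ih.comp hT))

theorem integrable_maxBirkhoffSum [IsFiniteMeasure μ] (hT : Measurable T) (hf : Measurable f)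
    {C : ℝ} (hC : ∀ x, |f x| ≤ C) (n : ℕ) : Integrable (maxBirkhoffSum T f n) μ := by
  refine Integrable.of_bound (measurable_maxBirkhoffSum hT hf n).aestronglyMeasurable (n * C)
    (ae_of_all _ fun x => ?_)
  rw [Real.norm_of_nonneg (maxBirkhoffSum_nonneg T f n x)]
  exact maxBirkhoffSum_le T hC n x

/-- Birkhoff sums of a bounded function with negative mean are bounded above. -/
theorem ae_bddAbove_maxBirkhoffSum [IsFiniteMeasure μ] (hT : Ergodic T μ) (hf : Measurable f)
    {C : ℝ} (hC : ∀ x, |f x| ≤ C) (hneg : ∫ x, f x ∂μ < 0) :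
    ∀ᵐ x ∂μ, BddAbove (range fun n => maxBirkhoffSum T f n x) := by
  have hTm := hT.toMeasurePreserving.measurable
  have hM := measurable_maxBirkhoffSum hTm hf
  let B : Set X := {x | BddAbove (range fun n => maxBirkhoffSum T f n x)}
  have hB : MeasurableSet B := measurableSet_bddAbove_range hM
  -- With `M n` the maximal sums, `M n ≤ max 0 (f + M n ∘ T)` and `f + M n ∘ T ≤ M (n + 1)`, so
  -- boundedness at `x` and at `T x` are equivalent.
  have hinv : T ⁻¹' B = B := by
    ext x
    constructor
    · rintro ⟨c, hc⟩
      refine ⟨max 0 (f x + c), ?_⟩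
      rintro _ ⟨n, rfl⟩
      refine (maxBirkhoffSum_le_succ T f n x).trans (max_le_max le_rfl ?_)
      have := hc ⟨n, rfl⟩
      simp only at this
      linarith
    · rintro ⟨c, hc⟩
      refine ⟨c - f x, ?_⟩
      rintro _ ⟨n, rfl⟩
      have h1 := hc ⟨n + 1, rfl⟩
      have h2 : f x + maxBirkhoffSum T f n (T x) ≤ maxBirkhoffSum T f (n + 1) x := le_max_right _ _
      simp only at h1 ⊢
      linarith
  rcases hT.toPreErgodic.ae_mem_or_ae_notMem hB hinv with h | h
  · exact h
  · exfalso
    -- `M n ∘ T` has the same integral as `M n`, which is at most that of `M (n + 1)`.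
    have key : ∀ n, 0 ≤ ∫ x, (maxBirkhoffSum T f (n + 1) x - maxBirkhoffSum T f n (T x)) ∂μ := by
      intro n
      have hi := integrable_maxBirkhoffSum (μ := μ) hTm hf hC
      have hi' : Integrable (fun x => maxBirkhoffSum T f n (T x)) μ :=
        (hT.toMeasurePreserving.integrable_comp (hi n).aestronglyMeasurable).2 (hi n)
      rw [integral_sub (hi _) hi']
      have : ∫ x, maxBirkhoffSum T f n (T x) ∂μ = ∫ x, maxBirkhoffSum T f n x ∂μ := by
        have hs : AEStronglyMeasurable (maxBirkhoffSum T f n) (μ.map T) := by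
          rw [hT.toMeasurePreserving.map_eq]
          exact (hi n).aestronglyMeasurable
        rw [← integral_map hTm.aemeasurable hs, hT.toMeasurePreserving.map_eq]
      rw [this, sub_nonneg]
      exact integral_mono (hi n) (hi _) (maxBirkhoffSum_le_succ T f n)
    -- The integrand is `max (-M n (T x)) (f x)`. It is dominated by `C` and equals `f x` as soon as
    -- `M n (T x)` exceeds `-f x`, which happens almost everywhere off `B`. In the limit `∫ f ≥ 0`,
    -- a contradiction.
    have hlim : Tendsto (fun n => ∫ x, (maxBirkhoffSum T f (n + 1) x
        - maxBirkhoffSum T f n (T x)) ∂μ) atTop (𝓝 (∫ x, f x ∂μ)) := by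
      refine tendsto_integral_of_dominated_convergence (fun _ => C)
        (fun n => ((hM (n + 1)).sub ((hM n).comp hTm)).aestronglyMeasurable)
        (integrable_const C) (fun n => ae_of_all _ fun x => ?_) ?_
      · have h0 := maxBirkhoffSum_nonneg T f n (T x)
        have h1 := abs_le.1 (hC x)
        rw [Real.norm_eq_abs, maxBirkhoffSum, abs_le]
        constructor
        · linarith [le_max_right 0 (f x + maxBirkhoffSum T f n (T x))]
        · rw [sub_le_iff_le_add]
          exact max_le (by linarith) (by linarith)
      · filter_upwards [h] with x hx
        have hx' : T x ∉ B := fun h' => hx (by rw [← hinv]; exact h')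
        obtain ⟨N, hN⟩ : ∃ N, -f x < maxBirkhoffSum T f N (T x) := by
          by_contra! hcon
          exact hx' ⟨-f x, by rintro _ ⟨n, rfl⟩; exact hcon n⟩
        refine tendsto_const_nhds.congr' ?_
        filter_upwards [eventually_ge_atTop N] with n hn
        have := monotone_nat_of_le_succ (f := fun n => maxBirkhoffSum T f n (T x))
          (fun n => maxBirkhoffSum_le_succ T f n (T x)) hn
        simp only at this
        rw [maxBirkhoffSum, max_eq_right (by linarith)]
        ring
    exact absurd (ge_of_tendsto' hlim key) (not_le.2 hneg)

/-- For `d` strictly between the mean and `c`, the sums of `f - d` stay below some `K`, so the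
averages of `f` are at most `d + K / n`. -/
theorem ae_eventually_birkhoffAverage_lt [IsProbabilityMeasure μ] (hT : Ergodic T μ)
    (hf : Measurable f) {C : ℝ} (hC : ∀ x, |f x| ≤ C) {c : ℝ} (hc : ∫ x, f x ∂μ < c) :
    ∀ᵐ x ∂μ, ∀ᶠ n in atTop, birkhoffAverage ℝ T f n x < c := by
  obtain ⟨d, hd, hdc⟩ := exists_between hc
  have hint : Integrable f μ := Integrable.of_bound hf.aestronglyMeasurable C
    (ae_of_all _ hC)
  have hneg : ∫ x, (f x - d) ∂μ < 0 := by
    rw [integral_sub hint (integrable_const d)]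
    simpa using hd
  have hb : ∀ x, |f x - d| ≤ C + |d| := fun x =>
    (abs_sub _ _).trans (by linarith [hC x])
  filter_upwards [ae_bddAbove_maxBirkhoffSum hT (hf.sub_const d) hb hneg] with x hx
  obtain ⟨K, hK⟩ := hx
  obtain ⟨n₀, hn₀⟩ := exists_nat_gt (K / (c - d))
  filter_upwards [eventually_gt_atTop n₀] with n hn
  have hn' : (n₀ : ℝ) < n := by exact_mod_cast hn
  have hpos : (0 : ℝ) < n := lt_of_le_of_lt (by positivity) hn'
  have h1 := (birkhoffSum_le_maxBirkhoffSum T (fun x => f x - d) n x).trans (hK ⟨n, rfl⟩)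
  have h2 : birkhoffSum T (fun x => f x - d) n x = birkhoffSum T f n x - n * d := by
    simp [birkhoffSum, Finset.sum_sub_distrib]
  have h3 : K < (c - d) * n := by
    rw [div_lt_iff₀ (by linarith)] at hn₀
    nlinarith
  rw [birkhoffAverage, smul_eq_mul, inv_mul_lt_iff₀ hpos]
  linarith

/-- Birkhoff's ergodic theorem for bounded functions and ergodic transformations. -/
theorem ae_tendsto_birkhoffAverage [IsProbabilityMeasure μ] (hT : Ergodic T μ)
    (hf : Measurable f) {C : ℝ} (hC : ∀ x, |f x| ≤ C) :
    ∀ᵐ x ∂μ, Tendsto (fun n => birkhoffAverage ℝ T f n x) atTop (𝓝 (∫ x, f x ∂μ)) := by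
  have hu : ∀ᵐ x ∂μ, ∀ k : ℕ, ∀ᶠ n in atTop,
      birkhoffAverage ℝ T f n x < ∫ x, f x ∂μ + 1 / (k + 1 : ℝ) := by
    rw [ae_all_iff]
    intro k
    exact ae_eventually_birkhoffAverage_lt hT hf hC (lt_add_of_pos_right _ Nat.one_div_pos_of_nat)
  -- The lower bound is the upper bound for `-f`.
  have hl : ∀ᵐ x ∂μ, ∀ k : ℕ, ∀ᶠ n in atTop,
      birkhoffAverage ℝ T (fun x => -f x) n x < ∫ x, -f x ∂μ + 1 / (k + 1 : ℝ) := by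
    rw [ae_all_iff]
    intro k
    exact ae_eventually_birkhoffAverage_lt (f := fun x => -f x) hT hf.neg (by simpa using hC)
      (lt_add_of_pos_right _ Nat.one_div_pos_of_nat)
  filter_upwards [hu, hl] with x h1 h2
  rw [tendsto_order]
  constructor
  · intro a ha
    obtain ⟨k, hk⟩ := exists_nat_one_div_lt (sub_pos.2 ha)
    filter_upwards [h2 k] with n hn
    have : birkhoffAverage ℝ T (fun x => -f x) n x = -birkhoffAverage ℝ T f n x := by
      simp [birkhoffAverage, birkhoffSum]
    rw [this, integral_neg] at hn
    linarith
  · intro a ha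
    obtain ⟨k, hk⟩ := exists_nat_one_div_lt (sub_pos.2 ha)
    filter_upwards [h1 k] with n hn
    linarith

end Birkhoff

/-! ### Limit frequencies of a stationary ergodic sequence -/

noncomputable section

namespace Snowflake

theorem ae_tendsto_freq {Ω : Type*} [MeasurableSpace Ω] {P : Measure Ω} [IsProbabilityMeasure P]
    {ξ : ℕ → Ω → ℕ} (hmeas : ∀ n, Measurable (ξ n)) (herg : StationaryErgodic P ξ) (a : ℕ) :
    ∀ᵐ ω ∂P, Tendsto (freq (fun n => ξ n ω) a) atTop (𝓝 (P.real {ω | ξ 0 ω = a})) := by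
  have hX : Measurable (fun ω n => ξ n ω) := measurable_pi_lambda _ hmeas
  have := Measure.isProbabilityMeasure_map (μ := P) hX.aemeasurable
  let f : (ℕ → ℕ) → ℝ := indicator {x | x 0 = a} 1
  have hs : MeasurableSet {x : ℕ → ℕ | x 0 = a} :=
    measurable_pi_apply (X := fun _ : ℕ => ℕ) 0 (measurableSet_singleton a)
  have hf : Measurable f := measurable_one.indicator hs
  have h := ae_of_ae_map hX.aemeasurable (ae_tendsto_birkhoffAverage (C := 1) herg hf (by
    intro x
    by_cases hx : x 0 = a <;> simp [f, hx]))
  have hval : ∫ x, f x ∂(P.map fun ω n => ξ n ω) = P.real {ω | ξ 0 ω = a} := by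
    rw [integral_indicator_one hs, map_measureReal_apply hX hs]
    rfl
  rw [hval] at h
  filter_upwards [h] with ω hω
  refine hω.congr fun n => ?_
  have hit : ∀ (k : ℕ) (x : ℕ → ℕ),
      (fun (x : ℕ → ℕ) n => x (n + 1))^[k] x = fun n => x (n + k) := by
    intro k
    induction k with
    | zero => intro x; rfl
    | succ k ih =>
      intro x
      rw [Function.iterate_succ_apply, ih]
      funext n
      rw [add_assoc, add_comm k]
  simp only [birkhoffAverage, birkhoffSum, freq, hit, one_div, smul_eq_mul, f, indicator,
    mem_ofPred_eq, zero_add, Pi.one_apply]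

/-! ### Coordinates with respect to the basis `1, exp (i π / 3)` -/

/-- The first coordinate with respect to the basis `1, exp (i π / 3)` of `ℂ`. -/
def cu (z : ℂ) : ℝ := z.re - z.im / √3

/-- The second coordinate with respect to the basis `1, exp (i π / 3)` of `ℂ`. -/
def cv (z : ℂ) : ℝ := 2 * z.im / √3

theorem cu_add (z w : ℂ) : cu (z + w) = cu z + cu w := by
  simp only [cu, Complex.add_re, Complex.add_im]; ring

theorem cv_add (z w : ℂ) : cv (z + w) = cv z + cv w := by
  simp only [cv, Complex.add_im]; ring

theorem cu_sub (z w : ℂ) : cu (z - w) = cu z - cu w := by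
  simp only [cu, Complex.sub_re, Complex.sub_im]; ring

theorem cv_sub (z w : ℂ) : cv (z - w) = cv z - cv w := by
  simp only [cv, Complex.sub_im]; ring

theorem cu_mul (r : ℝ) (z : ℂ) : cu (r * z) = r * cu z := by
  simp only [cu, Complex.re_ofReal_mul, Complex.im_ofReal_mul]; ring

theorem cv_mul (r : ℝ) (z : ℂ) : cv (r * z) = r * cv z := by
  simp only [cv, Complex.im_ofReal_mul]; ring

@[simp] theorem cu_ofReal (r : ℝ) : cu r = r := by simp [cu]

@[simp] theorem cv_ofReal (r : ℝ) : cv r = 0 := by simp [cv]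

@[simp] theorem cu_zero : cu 0 = 0 := by simp [cu]

@[simp] theorem cv_zero : cv 0 = 0 := by simp [cv]

@[simp] theorem cu_one : cu 1 = 1 := by simp [cu]

@[simp] theorem cv_one : cv 1 = 0 := by simp [cv]

@[fun_prop] theorem continuous_cu : Continuous cu := by unfold cu; fun_prop

@[fun_prop] theorem continuous_cv : Continuous cv := by unfold cv; fun_prop

theorem ext_coords {z w : ℂ} (hu : cu z = cu w) (hv : cv z = cv w) : z = w := by
  have h3 : (0 : ℝ) < √3 := by positivity
  have him : z.im = w.im := by
    simp only [cv] at hv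
    field_simp at hv
    linarith
  refine Complex.ext ?_ him
  simp only [cu, him] at hu
  linarith

theorem norm_sq_eq (z : ℂ) : ‖z‖ ^ 2 = cu z ^ 2 + cu z * cv z + cv z ^ 2 := by
  have h3 : √3 ^ 2 = (3 : ℝ) := Real.sq_sqrt (by norm_num)
  rw [← Complex.normSq_eq_norm_sq, Complex.normSq_apply, cu, cv]
  field_simp
  ring_nf
  rw [h3]

theorem two_mul_re (z : ℂ) : 2 * z.re = 2 * cu z + cv z := by
  simp only [cu, cv]; ring

/-- The unit vector at angle `π / 3`. -/
def omega : ℂ := Complex.exp ((Real.pi / 3 : ℝ) * Complex.I)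

theorem omega_re : omega.re = 1 / 2 := by
  rw [omega, Complex.exp_ofReal_mul_I_re, Real.cos_pi_div_three]

theorem omega_im : omega.im = √3 / 2 := by
  rw [omega, Complex.exp_ofReal_mul_I_im, Real.sin_pi_div_three]

theorem apex_eq : apex = 1 - omega := by
  have h : apex = Complex.exp ((-(Real.pi / 3) : ℝ) * Complex.I) := by
    rw [apex]; push_cast; ring_nf
  apply Complex.ext
  · rw [h, Complex.exp_ofReal_mul_I_re, Real.cos_neg, Real.cos_pi_div_three, Complex.sub_re,
      omega_re, Complex.one_re]
    norm_num
  · rw [h, Complex.exp_ofReal_mul_I_im, Real.sin_neg, Real.sin_pi_div_three, Complex.sub_im,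
      omega_im, Complex.one_im]
    norm_num

/-- Since `omega ^ 2 = omega - 1`, multiplication by `omega` has an integer matrix in these
coordinates, and so has multiplication by `apex = 1 - omega`. Hence the inclusions between rhombi
and triangles below become linear inequalities. -/
theorem cu_omega_mul (z : ℂ) : cu (omega * z) = -cv z := by
  have h3 : √3 ^ 2 = (3 : ℝ) := Real.sq_sqrt (by norm_num)
  simp only [cu, cv, Complex.mul_re, Complex.mul_im, omega_re, omega_im]
  field_simp
  ring_nf
  rw [h3]
  ring

theorem cv_omega_mul (z : ℂ) : cv (omega * z) = cu z + cv z := by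
  have h3 : √3 ^ 2 = (3 : ℝ) := Real.sq_sqrt (by norm_num)
  simp only [cu, cv, Complex.mul_im, omega_re, omega_im]
  field_simp
  ring

theorem cu_omega : cu omega = 0 := by
  simpa using cu_omega_mul 1

theorem cv_omega : cv omega = 1 := by
  simpa using cv_omega_mul 1

theorem cu_apex_mul (z : ℂ) : cu (apex * z) = cu z + cv z := by
  rw [apex_eq, sub_mul, cu_sub, cu_omega_mul, one_mul]; ring

theorem cv_apex_mul (z : ℂ) : cv (apex * z) = -cu z := by
  rw [apex_eq, sub_mul, cv_sub, cv_omega_mul, one_mul]; ring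

theorem cu_apex : cu apex = 1 := by
  simpa using cu_apex_mul 1

theorem cv_apex : cv apex = -1 := by
  simpa using cv_apex_mul 1

theorem norm_omega : ‖omega‖ = 1 := Complex.norm_exp_ofReal_mul_I _

theorem norm_apex : ‖apex‖ = 1 := by
  have := norm_sq_eq apex
  rw [cu_apex, cv_apex] at this
  nlinarith [norm_nonneg apex]

/-! ### The similarities in coordinates -/

theorem dir_flat (k : ℕ) : dir (3 * k) = 1 := by
  simp [dir]

theorem dir_up (k : ℕ) : dir (3 * k + 1) = omega := by
  have : (3 * k + 1) % 3 = 1 := by omega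
  simp only [dir, this, omega]
  norm_num

theorem dir_down (k : ℕ) : dir (3 * k + 2) = apex := by
  have : (3 * k + 2) % 3 = 2 := by omega
  simp only [dir, this, apex]
  norm_num

theorem norm_dir (j : ℕ) : ‖dir j‖ = 1 := by
  have h : j % 3 = 0 ∨ j % 3 = 1 ∨ j % 3 = 2 := by omega
  have e := Nat.div_add_mod j 3
  rcases h with h | h | h <;> rw [h] at e <;> rw [← e]
  · simp [dir_flat]
  · rw [dir_up, norm_omega]
  · rw [dir_down, norm_apex]

/-- Each triple flat, up, down advances by `1 + omega + (1 - omega) = 2`. -/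
theorem sum_dir_flat (k : ℕ) : ∑ j ∈ Finset.range (3 * k), dir j = 2 * k := by
  induction k with
  | zero => simp
  | succ k ih =>
    rw [show 3 * (k + 1) = 3 * k + 1 + 1 + 1 by ring, Finset.sum_range_succ, Finset.sum_range_succ,
      Finset.sum_range_succ, ih, dir_flat, dir_up, dir_down, apex_eq]
    push_cast
    ring

theorem ell_pos (a : ℕ) : (0 : ℝ) < ell a := by
  rw [ell]; positivity

theorem ell_cast (a : ℕ) : (ell a : ℝ) = 2 * a + 1 := by
  simp [ell]

theorem three_le_ell {a : ℕ} (ha : 1 ≤ a) : (3 : ℝ) ≤ ell a := by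
  have : (1 : ℝ) ≤ a := by exact_mod_cast ha
  rw [ell_cast]; linarith

theorem ell_mul_sim (a j : ℕ) (z : ℂ) :
    ((ell a : ℝ) : ℂ) * sim a j z = (∑ i ∈ Finset.range j, dir i) + dir j * z := by
  have h : ((ell a : ℕ) : ℂ) ≠ 0 := by exact_mod_cast (ell_pos a).ne'
  rw [sim, vertex]
  push_cast
  field_simp

theorem ell_mul_sim_flat (a k : ℕ) (z : ℂ) :
    ((ell a : ℝ) : ℂ) * sim a (3 * k) z = ((2 * k : ℝ) : ℂ) + z := by
  rw [ell_mul_sim, sum_dir_flat, dir_flat]; push_cast; ring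

theorem ell_mul_sim_up (a k : ℕ) (z : ℂ) :
    ((ell a : ℝ) : ℂ) * sim a (3 * k + 1) z = ((2 * k + 1 : ℝ) : ℂ) + omega * z := by
  rw [ell_mul_sim, Finset.sum_range_succ, sum_dir_flat, dir_flat, dir_up]; push_cast; ring

theorem ell_mul_sim_down (a k : ℕ) (z : ℂ) :
    ((ell a : ℝ) : ℂ) * sim a (3 * k + 2) z = ((2 * k + 1 : ℝ) : ℂ) + omega + apex * z := by
  rw [ell_mul_sim, Finset.sum_range_succ, Finset.sum_range_succ, sum_dir_flat, dir_flat, dir_up,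
    dir_down]
  push_cast
  ring

theorem cu_sim_flat (a k : ℕ) (z : ℂ) : ell a * cu (sim a (3 * k) z) = 2 * k + cu z := by
  rw [← cu_mul, ell_mul_sim_flat, cu_add, cu_ofReal]

theorem cv_sim_flat (a k : ℕ) (z : ℂ) : ell a * cv (sim a (3 * k) z) = cv z := by
  rw [← cv_mul, ell_mul_sim_flat, cv_add, cv_ofReal, zero_add]

theorem cu_sim_up (a k : ℕ) (z : ℂ) : ell a * cu (sim a (3 * k + 1) z) = 2 * k + 1 - cv z := by
  rw [← cu_mul, ell_mul_sim_up, cu_add, cu_ofReal, cu_omega_mul, sub_eq_add_neg]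

theorem cv_sim_up (a k : ℕ) (z : ℂ) : ell a * cv (sim a (3 * k + 1) z) = cu z + cv z := by
  rw [← cv_mul, ell_mul_sim_up, cv_add, cv_ofReal, cv_omega_mul, zero_add]

theorem cu_sim_down (a k : ℕ) (z : ℂ) :
    ell a * cu (sim a (3 * k + 2) z) = 2 * k + 1 + cu z + cv z := by
  rw [← cu_mul, ell_mul_sim_down, cu_add, cu_add, cu_ofReal, cu_apex_mul, cu_omega]; ring

theorem cv_sim_down (a k : ℕ) (z : ℂ) : ell a * cv (sim a (3 * k + 2) z) = 1 - cu z := by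
  rw [← cv_mul, ell_mul_sim_down, cv_add, cv_add, cv_ofReal, cv_apex_mul, cv_omega]; ring

/-- A segment of the building block is flat, or a left or right side of a spike. -/
theorem index_cases {a j : ℕ} (hj : j < m a) :
    (∃ k ≤ a, j = 3 * k) ∨ (∃ k < a, j = 3 * k + 1) ∨ ∃ k < a, j = 3 * k + 2 := by
  have e := Nat.div_add_mod j 3
  have h : j % 3 = 0 ∨ j % 3 = 1 ∨ j % 3 = 2 := by omega
  rw [m] at hj
  rcases h with h | h | h
  · exact Or.inl ⟨j / 3, by omega, by omega⟩
  · exact Or.inr (Or.inl ⟨j / 3, by omega, by omega⟩)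
  · exact Or.inr (Or.inr ⟨j / 3, by omega, by omega⟩)

/-! ### Metric properties of the similarities -/

theorem dist_sim (a j : ℕ) (z w : ℂ) : dist (sim a j z) (sim a j w) = dist z w / ell a := by
  rw [dist_eq_norm, dist_eq_norm, sim, sim, add_sub_add_left_eq_sub, ← mul_sub, norm_mul, norm_div,
    norm_dir, Complex.norm_natCast]
  ring

theorem ell_mul_dist_sim (a j : ℕ) (z w : ℂ) : ell a * dist (sim a j z) (sim a j w) = dist z w := by
  rw [dist_sim]
  field_simp [(ell_pos a).ne']

theorem continuous_sim (a j : ℕ) : Continuous (sim a j) := by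
  unfold sim; fun_prop

theorem sim_injective (a j : ℕ) : Function.Injective (sim a j) := by
  intro z w h
  have := ell_mul_dist_sim a j z w
  rw [h, dist_self, mul_zero] at this
  exact dist_eq_zero.1 this.symm

theorem sim_surjective (a j : ℕ) : Function.Surjective (sim a j) := by
  intro w
  have h1 : dir j ≠ 0 := by rw [← norm_ne_zero_iff, norm_dir]; exact one_ne_zero
  have h2 : ((ell a : ℕ) : ℂ) ≠ 0 := by exact_mod_cast (ell_pos a).ne'
  refine ⟨(w - vertex a j) * ell a / dir j, ?_⟩
  rw [sim]
  field_simp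
  ring

/-- The similarities as homeomorphisms. -/
def simHomeo (a j : ℕ) : ℂ ≃ₜ ℂ where
  toEquiv := Equiv.ofBijective (sim a j) ⟨sim_injective a j, sim_surjective a j⟩
  continuous_toFun := continuous_sim a j
  continuous_invFun := by
    have : LipschitzWith (ell a)
        (Equiv.ofBijective (sim a j) ⟨sim_injective a j, sim_surjective a j⟩).symm := by
      refine LipschitzWith.of_dist_le_mul fun z w => ?_
      obtain ⟨z, rfl⟩ := sim_surjective a j z
      obtain ⟨w, rfl⟩ := sim_surjective a j w
      rw [NNReal.coe_natCast, ell_mul_dist_sim]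
      have h := fun z => Equiv.ofBijective_symm_apply_apply (sim a j)
        ⟨sim_injective a j, sim_surjective a j⟩ z
      rw [h, h]
    exact this.continuous

theorem isOpenMap_sim (a j : ℕ) : IsOpenMap (sim a j) := (simHomeo a j).isOpenMap

theorem sim_image_closedBall (a j : ℕ) (c : ℂ) (r : ℝ) :
    sim a j '' Metric.closedBall c (ell a * r) = Metric.closedBall (sim a j c) r := by
  ext w
  obtain ⟨z, rfl⟩ := sim_surjective a j w
  rw [(sim_injective a j).mem_set_image, Metric.mem_closedBall, Metric.mem_closedBall, dist_sim,
    div_le_iff₀ (ell_pos a), mul_comm]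

/-- The determinant of multiplication by a complex number, as a real linear map, is its squared
modulus. -/
theorem volume_sim_image (a j : ℕ) (S : Set ℂ) :
    volume (sim a j '' S) = ENNReal.ofReal (((ell a : ℝ) ^ 2)⁻¹) * volume S := by
  have h : sim a j = (fun z => vertex a j + z) ∘ Algebra.lmul ℝ ℂ (dir j / ell a) := rfl
  rw [h, image_comp, image_add_left, measure_preimage_add, Measure.addHaar_image_linearMap,
    ← Algebra.norm_apply, Algebra.norm_complex_apply, Complex.normSq_eq_norm_sq, norm_div, norm_dir,
    Complex.norm_natCast, abs_of_nonneg (by positivity), one_div, inv_pow]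

/-! ### Rhombi and triangles -/

/-- The open rhombus with diagonal `[0,1]` and angles `π / 3` at `0` and `1`. -/
def rhombus : Set ℂ :=
  {z | 0 < cu z + 2 * cv z ∧ cu z + 2 * cv z < 1 ∧ 0 < cu z - cv z ∧ cu z - cv z < 1}

/-- The closed rhombus with diagonal `[0,1]` and angles `π / 3` at `0` and `1`. -/
def closedRhombus : Set ℂ :=
  {z | 0 ≤ cu z + 2 * cv z ∧ cu z + 2 * cv z ≤ 1 ∧ 0 ≤ cu z - cv z ∧ cu z - cv z ≤ 1}

/-- The lower half of the open rhombus. -/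
def lowerRhombus : Set ℂ := {z | cv z < 0 ∧ 0 < cu z + 2 * cv z ∧ cu z - cv z < 1}

/-- The closed equilateral triangle with vertices `0`, `1` and `apex`. -/
def triangle : Set ℂ := {z | cv z ≤ 0 ∧ cu z ≤ 1 ∧ 0 ≤ cu z + cv z}

theorem rhombus_subset : rhombus ⊆ closedRhombus :=
  fun _ ⟨h1, h2, h3, h4⟩ => ⟨h1.le, h2.le, h3.le, h4.le⟩

theorem lowerRhombus_subset_rhombus : lowerRhombus ⊆ rhombus :=
  fun _ ⟨h1, h2, h3⟩ => ⟨h2, by linarith, by linarith, h3⟩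

theorem lowerRhombus_subset_triangle : lowerRhombus ⊆ triangle :=
  fun _ ⟨h1, h2, h3⟩ => ⟨h1.le, by linarith, by linarith⟩

theorem isOpen_rhombus : IsOpen rhombus :=
  (isOpen_lt (by fun_prop) (by fun_prop)).and <|
    (isOpen_lt (by fun_prop) (by fun_prop)).and <|
      (isOpen_lt (by fun_prop) (by fun_prop)).and (isOpen_lt (by fun_prop) (by fun_prop))

theorem isOpen_lowerRhombus : IsOpen lowerRhombus :=
  (isOpen_lt (by fun_prop) (by fun_prop)).and <|
    (isOpen_lt (by fun_prop) (by fun_prop)).and (isOpen_lt (by fun_prop) (by fun_prop))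

theorem isClosed_closedRhombus : IsClosed closedRhombus :=
  (isClosed_le (by fun_prop) (by fun_prop)).and <|
    (isClosed_le (by fun_prop) (by fun_prop)).and <|
      (isClosed_le (by fun_prop) (by fun_prop)).and (isClosed_le (by fun_prop) (by fun_prop))

theorem isClosed_triangle : IsClosed triangle :=
  (isClosed_le (by fun_prop) (by fun_prop)).and <|
    (isClosed_le (by fun_prop) (by fun_prop)).and (isClosed_le (by fun_prop) (by fun_prop))

theorem closedRhombus_subset_closedBall : closedRhombus ⊆ Metric.closedBall 0 1 := by
  rintro z ⟨h1, h2, h3, h4⟩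
  rw [mem_closedBall_zero_iff]
  have h := norm_sq_eq z
  -- With `p = cu z + 2 * cv z` and `q = cu z - cv z`, both in `[0,1]`, one has `‖z‖ ^ 2 = (p ^ 2 +
  -- p * q + q ^ 2) / 3`.
  have : ‖z‖ ^ 2 ≤ 1 := by
    rw [h]
    nlinarith [mul_nonneg (sub_nonneg.2 h2) h1, mul_nonneg (sub_nonneg.2 h4) h3,
      mul_nonneg (sub_nonneg.2 h2) h3]
  exact (sq_le_one_iff₀ (norm_nonneg z)).1 this

theorem triangle_subset_closedBall : triangle ⊆ Metric.closedBall 0 1 := by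
  rintro z ⟨h1, h2, h3⟩
  rw [mem_closedBall_zero_iff]
  have h := norm_sq_eq z
  have : ‖z‖ ^ 2 ≤ 1 := by
    rw [h]
    nlinarith [mul_nonneg (neg_nonneg.2 h1) h3]
  exact (sq_le_one_iff₀ (norm_nonneg z)).1 this

theorem lowerRhombus_nonempty : lowerRhombus.Nonempty := by
  refine ⟨((1 / 2 : ℝ) : ℂ) + ((-1 / 8 : ℝ) : ℂ) * omega, ?_⟩
  rw [lowerRhombus, mem_ofPred_eq, cu_add, cv_add, cu_mul, cv_mul, cu_ofReal, cv_ofReal, cu_omega,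
    cv_omega]
  norm_num

theorem zero_mem_closedRhombus : (0 : ℂ) ∈ closedRhombus := by
  simp [closedRhombus]

theorem sim_image_closedRhombus {a j : ℕ} (hj : j < m a) :
    sim a j '' closedRhombus ⊆ closedRhombus := by
  rintro _ ⟨z, ⟨h1, h2, h3, h4⟩, rfl⟩
  have hl := ell_pos a
  have e := ell_cast a
  rcases index_cases hj with ⟨k, hk, rfl⟩ | ⟨k, hk, rfl⟩ | ⟨k, hk, rfl⟩
  · have hu := cu_sim_flat a k z
    have hv := cv_sim_flat a k z
    have hk' : (k : ℝ) ≤ a := by exact_mod_cast hk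
    have h0 : (0 : ℝ) ≤ k := by positivity
    refine ⟨?_, ?_, ?_, ?_⟩ <;> refine le_of_mul_le_mul_left ?_ hl <;> linarith
  · have hu := cu_sim_up a k z
    have hv := cv_sim_up a k z
    have hk' : (k : ℝ) + 1 ≤ a := by exact_mod_cast hk
    have h0 : (0 : ℝ) ≤ k := by positivity
    refine ⟨?_, ?_, ?_, ?_⟩ <;> refine le_of_mul_le_mul_left ?_ hl <;> linarith
  · have hu := cu_sim_down a k z
    have hv := cv_sim_down a k z
    have hk' : (k : ℝ) + 1 ≤ a := by exact_mod_cast hk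
    have h0 : (0 : ℝ) ≤ k := by positivity
    refine ⟨?_, ?_, ?_, ?_⟩ <;> refine le_of_mul_le_mul_left ?_ hl <;> linarith

/-- Half of the open set condition. A rhombus on a side of spike `k` reaches up to `2 * k + 3` in
the rescaled coordinate `cu + 2 * cv` or `cu - cv`, and `k < a` gives exactly `2 * k + 3 ≤ ell a`:
the spikes just fit. -/
theorem sim_image_rhombus {a j : ℕ} (hj : j < m a) : sim a j '' rhombus ⊆ rhombus := by
  rintro _ ⟨z, ⟨h1, h2, h3, h4⟩, rfl⟩
  have hl := ell_pos a
  have e := ell_cast a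
  rcases index_cases hj with ⟨k, hk, rfl⟩ | ⟨k, hk, rfl⟩ | ⟨k, hk, rfl⟩
  · have hu := cu_sim_flat a k z
    have hv := cv_sim_flat a k z
    have hk' : (k : ℝ) ≤ a := by exact_mod_cast hk
    have h0 : (0 : ℝ) ≤ k := by positivity
    refine ⟨?_, ?_, ?_, ?_⟩ <;> refine lt_of_mul_lt_mul_left ?_ hl.le <;> linarith
  · have hu := cu_sim_up a k z
    have hv := cv_sim_up a k z
    have hk' : (k : ℝ) + 1 ≤ a := by exact_mod_cast hk
    have h0 : (0 : ℝ) ≤ k := by positivity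
    refine ⟨?_, ?_, ?_, ?_⟩ <;> refine lt_of_mul_lt_mul_left ?_ hl.le <;> linarith
  · have hu := cu_sim_down a k z
    have hv := cv_sim_down a k z
    have hk' : (k : ℝ) + 1 ≤ a := by exact_mod_cast hk
    have h0 : (0 : ℝ) ≤ k := by positivity
    refine ⟨?_, ?_, ?_, ?_⟩ <;> refine lt_of_mul_lt_mul_left ?_ hl.le <;> linarith

/-- The images of the rhombus lie in disjoint vertical strips. -/
theorem sim_rhombus_strip (a j : ℕ) {z : ℂ} (hz : z ∈ rhombus) :
    ∃ k : ℕ, (j = 3 * k ∧ 4 * k < ell a * (2 * (sim a j z).re) ∧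
        ell a * (2 * (sim a j z).re) < 4 * k + 2) ∨
      (j = 3 * k + 1 ∧ 4 * k + 2 < ell a * (2 * (sim a j z).re) ∧
        ell a * (2 * (sim a j z).re) < 4 * k + 3) ∨
      (j = 3 * k + 2 ∧ 4 * k + 3 < ell a * (2 * (sim a j z).re) ∧
        ell a * (2 * (sim a j z).re) < 4 * k + 4) := by
  obtain ⟨h1, h2, h3, h4⟩ := hz
  have e := Nat.div_add_mod j 3
  refine ⟨j / 3, ?_⟩
  -- In units of half a segment, a flat rhombus has horizontal width 2. A slanted one has two
  -- vertical edges, hence width only 1, the same as its segment.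
  rw [two_mul_re]
  generalize j / 3 = k at *
  have h : j % 3 = 0 ∨ j % 3 = 1 ∨ j % 3 = 2 := by omega
  rcases h with h | h | h <;> rw [h] at e <;> subst e
  · have hu := cu_sim_flat a k z
    have hv := cv_sim_flat a k z
    exact Or.inl ⟨rfl, by simp only [add_zero]; linarith, by simp only [add_zero]; linarith⟩
  · have hu := cu_sim_up a k z
    have hv := cv_sim_up a k z
    exact Or.inr (Or.inl ⟨rfl, by linarith, by linarith⟩)
  · have hu := cu_sim_down a k z
    have hv := cv_sim_down a k z
    exact Or.inr (Or.inr ⟨rfl, by linarith, by linarith⟩)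

theorem sim_rhombus_disjoint (a : ℕ) {i j : ℕ} (hij : i ≠ j) :
    Disjoint (sim a i '' rhombus) (sim a j '' rhombus) := by
  rw [Set.disjoint_left]
  rintro _ ⟨z, hz, rfl⟩ ⟨w, hw, e⟩
  obtain ⟨k, hk⟩ := sim_rhombus_strip a i hz
  obtain ⟨l, hl⟩ := sim_rhombus_strip a j hw
  rw [e] at hl
  have key : k < l ∨ k = l ∨ l < k := lt_trichotomy k l
  rcases key with h | h | h
  · have h' : (k : ℝ) + 1 ≤ l := by exact_mod_cast h
    rcases hk with hk | hk | hk <;> rcases hl with hl | hl | hl <;>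
      linarith [hk.2.1, hk.2.2, hl.2.1, hl.2.2]
  · subst h
    rcases hk with hk | hk | hk <;> rcases hl with hl | hl | hl <;>
      first | exact hij (hk.1.trans hl.1.symm) | linarith [hk.2.1, hk.2.2, hl.2.1, hl.2.2]
  · have h' : (l : ℝ) + 1 ≤ k := by exact_mod_cast h
    rcases hk with hk | hk | hk <;> rcases hl with hl | hl | hl <;>
      linarith [hk.2.1, hk.2.2, hl.2.1, hl.2.2]

/-! ### Iterated function systems -/

/-- The left shift of a sequence. -/
def shift (x : ℕ → ℕ) : ℕ → ℕ := fun i => x (i + 1)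

/-- The `n`-th iteration of the construction, starting from an arbitrary set. -/
def iter (B : Set ℂ) : ℕ → (ℕ → ℕ) → Set ℂ
  | 0, _ => B
  | n + 1, x => ⋃ j ∈ Finset.range (m (x 0)), sim (x 0) j '' iter B n (shift x)

/-- The number of segments after `n` steps. -/
def count (n : ℕ) (x : ℕ → ℕ) : ℝ := ∏ i ∈ Finset.range n, (m (x i) : ℝ)

/-- The reciprocal of the length of the segments after `n` steps. -/
def scale (n : ℕ) (x : ℕ → ℕ) : ℝ := ∏ i ∈ Finset.range n, (ell (x i) : ℝ)

@[simp] theorem count_zero (x : ℕ → ℕ) : count 0 x = 1 := by simp [count]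

@[simp] theorem scale_zero (x : ℕ → ℕ) : scale 0 x = 1 := by simp [scale]

theorem count_succ (n : ℕ) (x : ℕ → ℕ) : count (n + 1) x = m (x 0) * count n (shift x) := by
  rw [count, Finset.prod_range_succ', mul_comm]; rfl

theorem scale_succ (n : ℕ) (x : ℕ → ℕ) : scale (n + 1) x = ell (x 0) * scale n (shift x) := by
  rw [scale, Finset.prod_range_succ', mul_comm]; rfl

theorem count_pos (n : ℕ) (x : ℕ → ℕ) : 0 < count n x :=
  Finset.prod_pos fun i _ => by rw [m]; positivity

theorem scale_pos (n : ℕ) (x : ℕ → ℕ) : 0 < scale n x :=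
  Finset.prod_pos fun _ _ => ell_pos _

theorem three_pow_le_scale {x : ℕ → ℕ} (hx : ∀ i, 1 ≤ x i) (n : ℕ) : 3 ^ n ≤ scale n x := by
  simpa [scale] using Finset.prod_le_prod (s := Finset.range n) (f := fun _ => (3 : ℝ))
    (fun i _ => by norm_num) (fun i _ => three_le_ell (hx i))

theorem mem_iter_succ {B : Set ℂ} {n : ℕ} {x : ℕ → ℕ} {z : ℂ} :
    z ∈ iter B (n + 1) x ↔ ∃ j < m (x 0), ∃ w ∈ iter B n (shift x), sim (x 0) j w = z := by
  simp only [iter, mem_iUnion, Finset.mem_range, mem_image, exists_prop]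

theorem iter_mono {B C : Set ℂ} (h : B ⊆ C) (n : ℕ) : ∀ x, iter B n x ⊆ iter C n x := by
  induction n with
  | zero => exact fun _ => h
  | succ n ih => exact fun x => iUnion₂_mono fun j _ => image_mono (ih (shift x))

theorem polygon_eq_iter (n : ℕ) : ∀ x, polygon n x = iter (segment ℝ (0 : ℂ) 1) n x := by
  induction n with
  | zero => exact fun _ => rfl
  | succ n ih =>
    intro x
    simp only [polygon, iter, ← ih]
    rfl

theorem isCompact_iter {B : Set ℂ} (hB : IsCompact B) (n : ℕ) : ∀ x, IsCompact (iter B n x) := by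
  induction n with
  | zero => exact fun _ => hB
  | succ n ih =>
    exact fun x => (Finset.range _).isCompact_biUnion fun j _ => (ih _).image (continuous_sim _ j)

theorem isOpen_iter {B : Set ℂ} (hB : IsOpen B) (n : ℕ) : ∀ x, IsOpen (iter B n x) := by
  induction n with
  | zero => exact fun _ => hB
  | succ n ih =>
    exact fun x => isOpen_biUnion fun j _ => isOpenMap_sim _ j _ (ih _)

theorem iter_add_subset {B C : Set ℂ} (hBC : ∀ k x, iter B k x ⊆ C) (n k : ℕ) :
    ∀ x, iter B (n + k) x ⊆ iter C n x := by
  induction n with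
  | zero => intro x; rw [zero_add]; exact hBC k x
  | succ n ih =>
    intro x
    rw [add_right_comm]
    exact iUnion₂_mono fun j _ => image_mono (ih (shift x))

theorem iter_subset_of_invariant {B C : Set ℂ} (hBC : B ⊆ C)
    (hC : ∀ a, ∀ j < m a, sim a j '' C ⊆ C) (n : ℕ) : ∀ x, iter B n x ⊆ C := by
  induction n with
  | zero => exact fun _ => hBC
  | succ n ih =>
    exact fun x => iUnion₂_subset fun j hj =>
      (image_mono (ih _)).trans (hC _ _ (Finset.mem_range.1 hj))

/-! ### The limiting curve -/

theorem segment_subset_closedRhombus : segment ℝ (0 : ℂ) 1 ⊆ closedRhombus := by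
  rw [segment_eq_image]
  rintro _ ⟨t, ⟨h0, h1⟩, rfl⟩
  have : ((1 - t) • (0 : ℂ) + t • (1 : ℂ)) = (t : ℂ) := by simp
  simp only [this]
  simp [closedRhombus, h0, h1]

/-- All later polygons are trapped in the closed rhombi of level `n`; this passes to the limit curve
in `curve_subset_iter`. -/
theorem polygon_add_subset (n k : ℕ) (x : ℕ → ℕ) : polygon (n + k) x ⊆ iter closedRhombus n x := by
  rw [polygon_eq_iter]
  exact iter_add_subset (fun k x => iter_subset_of_invariant segment_subset_closedRhombus
    (fun _ _ => sim_image_closedRhombus) k x) n k x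

theorem m_pos (a : ℕ) : 0 < m a := by rw [m]; positivity

theorem sim_zero_zero (a : ℕ) : sim a 0 0 = 0 := by simp [sim, vertex]

theorem sim_last_one (a : ℕ) : sim a (3 * a) 1 = 1 := by
  have hl := ell_pos a
  have h1 := cu_sim_flat a a 1
  have h2 := cv_sim_flat a a 1
  rw [cu_one, ← ell_cast] at h1
  rw [cv_one] at h2
  apply ext_coords
  · rw [cu_one]; exact mul_left_cancel₀ hl.ne' (by rw [h1, mul_one])
  · rw [cv_one]; exact mul_left_cancel₀ hl.ne' (by rw [h2, mul_zero])

theorem zero_mem_polygon (n : ℕ) : ∀ x, (0 : ℂ) ∈ polygon n x := by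
  induction n with
  | zero => exact fun _ => left_mem_segment ℝ _ _
  | succ n ih =>
    exact fun x => mem_biUnion (Finset.mem_range.2 (m_pos _)) ⟨0, ih _, sim_zero_zero _⟩

theorem one_mem_polygon (n : ℕ) : ∀ x, (1 : ℂ) ∈ polygon n x := by
  induction n with
  | zero => exact fun _ => right_mem_segment ℝ _ _
  | succ n ih =>
    exact fun x => mem_biUnion (Finset.mem_range.2 (Nat.lt_succ_self _)) ⟨1, ih _, sim_last_one _⟩

theorem mem_curve_of_forall_mem {x : ℕ → ℕ} {z : ℂ} (h : ∀ n, z ∈ polygon n x) : z ∈ curve x := by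
  refine tendsto_const_nhds.congr fun n => ?_
  rw [Metric.infDist_zero_of_mem (h n)]

theorem zero_mem_curve (x : ℕ → ℕ) : (0 : ℂ) ∈ curve x :=
  mem_curve_of_forall_mem fun n => zero_mem_polygon n x

theorem one_mem_curve (x : ℕ → ℕ) : (1 : ℂ) ∈ curve x :=
  mem_curve_of_forall_mem fun n => one_mem_polygon n x

theorem isClosed_curve (x : ℕ → ℕ) : IsClosed (curve x) := by
  refine isClosed_of_closure_subset fun z hz => ?_
  rw [curve, mem_ofPred_eq, Metric.tendsto_atTop]
  intro ε hε
  obtain ⟨y, hy, hzy⟩ := Metric.mem_closure_iff.1 hz (ε / 2) (by positivity)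
  rw [curve, mem_ofPred_eq, Metric.tendsto_atTop] at hy
  obtain ⟨n₀, hn₀⟩ := hy (ε / 2) (by positivity)
  refine ⟨n₀, fun n hn => ?_⟩
  have h1 := hn₀ n hn
  rw [Real.dist_eq, sub_zero, abs_of_nonneg Metric.infDist_nonneg] at h1 ⊢
  linarith [Metric.infDist_le_infDist_add_dist (s := polygon n x) (x := z) (y := y)]

theorem curve_subset_iter (n : ℕ) (x : ℕ → ℕ) : curve x ⊆ iter closedRhombus n x := by
  intro z hz
  have hc : IsClosed (iter closedRhombus n x) :=
    (isCompact_iter ((isCompact_closedBall 0 1).of_isClosed_subset isClosed_closedRhombus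
      closedRhombus_subset_closedBall) n x).isClosed
  have hne : (iter closedRhombus n x).Nonempty :=
    ⟨0, polygon_add_subset n 0 x (zero_mem_polygon _ x)⟩
  rw [hc.mem_iff_infDist_zero hne]
  refine le_antisymm ?_ Metric.infDist_nonneg
  refine ge_of_tendsto hz ?_
  filter_upwards [eventually_ge_atTop n] with k hk
  obtain ⟨l, rfl⟩ := Nat.exists_eq_add_of_le hk
  exact Metric.infDist_le_infDist_of_subset (polygon_add_subset n l x) ⟨0, zero_mem_polygon _ x⟩

theorem curve_subset_closedRhombus (x : ℕ → ℕ) : curve x ⊆ closedRhombus := curve_subset_iter 0 x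

/-- Level `n + 1` for `x` contains the image of level `n` for `shift x`, and `sim` does not increase
distances. Only this half of the self-similarity of the curve is needed. -/
theorem sim_mem_curve {x : ℕ → ℕ} {j : ℕ} (hj : j < m (x 0)) {z : ℂ} (hz : z ∈ curve (shift x)) :
    sim (x 0) j z ∈ curve x := by
  rw [curve, mem_ofPred_eq, ← tendsto_add_atTop_iff_nat 1]
  refine squeeze_zero (fun _ => Metric.infDist_nonneg) (fun n => ?_) hz
  refine (Metric.le_infDist ⟨0, zero_mem_polygon n _⟩).2 fun y hy => ?_
  refine (Metric.infDist_le_dist_of_mem (mem_biUnion (Finset.mem_range.2 hj)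
    (mem_image_of_mem _ hy))).trans ?_
  rw [dist_sim]
  refine div_le_self dist_nonneg ?_
  rw [ell_cast]
  linarith [(Nat.cast_nonneg (x 0) : (0 : ℝ) ≤ x 0)]

/-- Each level of the construction is covered by balls of the size of its segments. -/
theorem exists_cover {B : Set ℂ} (hB : B ⊆ Metric.closedBall 0 1) (n : ℕ) : ∀ x, ∃ F : Finset ℂ,
    (F.card : ℝ) ≤ count n x ∧ (F : Set ℂ) ⊆ iter {0} n x ∧
      iter B n x ⊆ ⋃ c ∈ F, Metric.closedBall c (scale n x)⁻¹ := by
  classical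
  induction n with
  | zero => exact fun x => ⟨{0}, by simp, by simp [iter], by simpa [iter] using hB⟩
  | succ n ih =>
    intro x
    obtain ⟨F, hF, hF0, hcov⟩ := ih (shift x)
    refine ⟨(Finset.range (m (x 0))).biUnion fun j => F.image (sim (x 0) j), ?_, ?_, ?_⟩
    · have h := Finset.card_biUnion_le_card_mul (Finset.range (m (x 0)))
        (fun j => F.image (sim (x 0) j)) F.card (fun j _ => Finset.card_image_le)
      rw [Finset.card_range] at h
      rw [count_succ]
      refine le_trans (by exact_mod_cast h) (mul_le_mul_of_nonneg_left hF (by positivity))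
    · intro c hc
      simp only [Finset.coe_biUnion, Finset.coe_range, mem_iUnion, Finset.coe_image] at hc
      obtain ⟨j, hj, w, hw, rfl⟩ := hc
      exact mem_iter_succ.2 ⟨j, hj, w, hF0 hw, rfl⟩
    · intro z hz
      obtain ⟨j, hj, w, hw, rfl⟩ := mem_iter_succ.1 hz
      obtain ⟨c, hc, hwc⟩ := mem_iUnion₂.1 (hcov hw)
      refine mem_iUnion₂.2 ⟨sim (x 0) j c, ?_, ?_⟩
      · exact Finset.mem_biUnion.2 ⟨j, Finset.mem_range.2 hj, Finset.mem_image_of_mem _ hc⟩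
      · rw [Metric.mem_closedBall, dist_sim, scale_succ, mul_inv, div_eq_inv_mul]
        exact mul_le_mul_of_nonneg_left hwc (by positivity)

/-- Puts the centres found in `exists_cover` on the curve itself, so that the covered points are
close to the boundary of the domain. -/
theorem iter_zero_subset_curve (n : ℕ) : ∀ x, iter {0} n x ⊆ curve x := by
  induction n with
  | zero => intro x; simpa [iter] using zero_mem_curve x
  | succ n ih =>
    intro x z hz
    obtain ⟨j, hj, w, hw, rfl⟩ := mem_iter_succ.1 hz
    exact sim_mem_curve hj (ih _ hw)

/-! ### The region below the curve -/

/-- The triangle below `[0,1]` together with the spikes of the first `n` steps. -/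
def fill : ℕ → (ℕ → ℕ) → Set ℂ
  | 0, _ => triangle
  | n + 1, x => triangle ∪ ⋃ j ∈ Finset.range (m (x 0)), sim (x 0) j '' fill n (shift x)

/-- The triangle below `[0,1]` together with all spikes and the limiting curve. -/
def filled (x : ℕ → ℕ) : Set ℂ := curve x ∪ ⋃ n, fill n x

theorem triangle_subset_fill (n : ℕ) (x : ℕ → ℕ) : triangle ⊆ fill n x := by
  cases n with
  | zero => exact subset_rfl
  | succ n => exact subset_union_left

theorem mem_fill_succ {n : ℕ} {x : ℕ → ℕ} {z : ℂ} :
    z ∈ fill (n + 1) x ↔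
      z ∈ triangle ∨ ∃ j < m (x 0), ∃ w ∈ fill n (shift x), sim (x 0) j w = z := by
  simp only [fill, mem_union, mem_iUnion, Finset.mem_range, mem_image, exists_prop]

theorem fill_subset_filled (n : ℕ) (x : ℕ → ℕ) : fill n x ⊆ filled x :=
  (subset_iUnion (fun n => fill n x) n).trans subset_union_right

theorem curve_subset_filled (x : ℕ → ℕ) : curve x ⊆ filled x := subset_union_left

theorem triangle_subset_filled (x : ℕ → ℕ) : triangle ⊆ filled x := fill_subset_filled 0 x

theorem sim_image_filled {x : ℕ → ℕ} {j : ℕ} (hj : j < m (x 0)) :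
    sim (x 0) j '' filled (shift x) ⊆ filled x := by
  rintro _ ⟨w, hw | hw, rfl⟩
  · exact Or.inl (sim_mem_curve hj hw)
  · obtain ⟨n, hn⟩ := mem_iUnion.1 hw
    exact fill_subset_filled (n + 1) x (mem_fill_succ.2 (Or.inr ⟨j, hj, w, hn, rfl⟩))

theorem sim_mem_interior_filled {x : ℕ → ℕ} {j : ℕ} (hj : j < m (x 0)) {w : ℂ}
    (hw : w ∈ interior (filled (shift x))) : sim (x 0) j w ∈ interior (filled x) :=
  interior_mono (sim_image_filled hj)
    ((isOpenMap_sim (x 0) j).image_interior_subset _ (mem_image_of_mem _ hw))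

/-- Zooming in on a piece multiplies the distance to the curve by at least `ell`. This expansion
makes the induction in `mem_interior_filled_of_real` stop. -/
theorem ell_mul_infDist_sim_le {x : ℕ → ℕ} {j : ℕ} (hj : j < m (x 0)) (w : ℂ) :
    ell (x 0) * Metric.infDist (sim (x 0) j w) (curve x) ≤ Metric.infDist w (curve (shift x)) := by
  refine (Metric.le_infDist ⟨0, zero_mem_curve _⟩).2 fun y hy => ?_
  rw [← ell_mul_dist_sim (x 0) j]
  exact mul_le_mul_of_nonneg_left (Metric.infDist_le_dist_of_mem (sim_mem_curve hj hy))
    (ell_pos _).le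

/-- The point lies inside the base of spike `k`. It has a neighbourhood whose lower half is in the
big triangle and whose upper half is in the spike, which is the image of `triangle` under the
similarity of its rising side. -/
theorem mem_interior_filled_of_spike {x : ℕ → ℕ} {k : ℕ} (hk : k < x 0) {t : ℝ} (h0 : 0 < t)
    (h1 : t < 1) (hl : 2 * k + 1 < ell (x 0) * t) (hr : ell (x 0) * t < 2 * k + 2) :
    (t : ℂ) ∈ interior (filled x) := by
  rw [mem_interior]
  refine ⟨{z | cu z < 1 ∧ 0 < cu z + cv z ∧ 2 * k + 1 < ell (x 0) * cu z ∧
    ell (x 0) * (cu z + cv z) < 2 * k + 2}, ?_, ?_, ?_⟩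
  · rintro z ⟨hz1, hz2, hz3, hz4⟩
    rcases le_total (cv z) 0 with hv | hv
    · exact triangle_subset_filled x ⟨hv, hz1.le, hz2.le⟩
    · obtain ⟨w, rfl⟩ := sim_surjective (x 0) (3 * k + 1) z
      refine sim_image_filled (by rw [m]; omega) (mem_image_of_mem _ (triangle_subset_filled _ ?_))
      have e1 := cu_sim_up (x 0) k w
      have e2 := cv_sim_up (x 0) k w
      have e3 := mul_nonneg (ell_pos (x 0)).le hv
      exact ⟨by linarith, by linarith, by linarith⟩
  · exact (isOpen_lt (by fun_prop) (by fun_prop)).and <|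
      (isOpen_lt (by fun_prop) (by fun_prop)).and <|
        (isOpen_lt (by fun_prop) (by fun_prop)).and (isOpen_lt (by fun_prop) (by fun_prop))
  · simp [h0, h1, hl, hr]

/-- Points of the base segment off the curve are interior to the filled region. -/
theorem mem_interior_filled_of_real {t : ℝ} {x : ℕ → ℕ} (hx : ∀ i, 1 ≤ x i) (h0 : 0 ≤ t)
    (h1 : t ≤ 1) (ht : (t : ℂ) ∉ curve x) : (t : ℂ) ∈ interior (filled x) := by
  -- Induction on the number of zooms: each multiplies the distance to the curve by at least 3,
  -- while on `[0,1]` this distance is at most 1 because `0` is on the curve.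
  obtain ⟨k, hk⟩ : ∃ k : ℕ, (1 / 3 : ℝ) ^ k < Metric.infDist (t : ℂ) (curve x) :=
    exists_pow_lt_of_lt_one (((isClosed_curve x).notMem_iff_infDist_pos ⟨0, zero_mem_curve x⟩).1 ht)
      (by norm_num)
  induction k generalizing x t with
  | zero =>
    have h := hk.trans_le (Metric.infDist_le_dist_of_mem (zero_mem_curve x))
    rw [pow_zero, dist_zero_right, Complex.norm_real, Real.norm_of_nonneg h0] at h
    linarith
  | succ k ih =>
    have hl := ell_pos (x 0)
    have hl3 := three_le_ell (hx 0)
    have el := ell_cast (x 0)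
    have ht0 : t ≠ 0 := fun h => ht (by rw [h, Complex.ofReal_zero]; exact zero_mem_curve x)
    have ht1 : t ≠ 1 := fun h => ht (by rw [h, Complex.ofReal_one]; exact one_mem_curve x)
    have h0' := lt_of_le_of_ne h0 ht0.symm
    have h1' := lt_of_le_of_ne h1 ht1
    have hfl := Nat.floor_le (a := ell (x 0) * t) (by positivity)
    have hlt := Nat.lt_floor_add_one (ell (x 0) * t)
    have hlt' : ⌊ell (x 0) * t⌋₊ < 2 * x 0 + 1 := by
      rw [Nat.floor_lt (by positivity)]
      push_cast
      nlinarith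
    obtain ⟨i, hi⟩ : ∃ i, i = ⌊ell (x 0) * t⌋₊ := ⟨_, rfl⟩
    rw [← hi] at hfl hlt hlt'
    -- Even intervals are flat segments, where one zooms in; odd intervals are bases of spikes.
    rcases Nat.even_or_odd' i with ⟨l, rfl | rfl⟩
    · push_cast at hfl hlt
      have hj : 3 * l < m (x 0) := by rw [m]; omega
      have hs : sim (x 0) (3 * l) ((ell (x 0) * t - 2 * l : ℝ) : ℂ) = t := by
        have e1 := cu_sim_flat (x 0) l ((ell (x 0) * t - 2 * l : ℝ) : ℂ)
        have e2 := cv_sim_flat (x 0) l ((ell (x 0) * t - 2 * l : ℝ) : ℂ)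
        rw [cu_ofReal] at e1
        rw [cv_ofReal] at e2
        apply ext_coords
        · rw [cu_ofReal]; exact mul_left_cancel₀ hl.ne' (by linarith)
        · rw [cv_ofReal]; exact mul_left_cancel₀ hl.ne' (by linarith)
      rw [← hs]
      refine sim_mem_interior_filled hj (ih (fun i => hx _) (by linarith) (by linarith) ?_ ?_)
      · intro h
        exact ht (hs ▸ sim_mem_curve hj h)
      · have h := ell_mul_infDist_sim_le hj ((ell (x 0) * t - 2 * l : ℝ) : ℂ)
        rw [hs] at h
        rw [pow_succ] at hk
        nlinarith [Metric.infDist_nonneg (x := (t : ℂ)) (s := curve x)]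
    · push_cast at hfl hlt
      refine mem_interior_filled_of_spike (k := l) (by omega) h0' h1' (lt_of_le_of_ne hfl ?_)
        (by linarith)
      -- The left end of the base of a spike is the right end of a flat segment, hence on the curve.
      intro h
      apply ht
      have hs : sim (x 0) (3 * l) 1 = t := by
        have e1 := cu_sim_flat (x 0) l 1
        have e2 := cv_sim_flat (x 0) l 1
        rw [cu_one] at e1
        rw [cv_one] at e2
        apply ext_coords
        · rw [cu_ofReal]; exact mul_left_cancel₀ hl.ne' (by linarith)
        · rw [cv_ofReal]; exact mul_left_cancel₀ hl.ne' (by linarith)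
      rw [← hs]
      exact sim_mem_curve (by rw [m]; omega) (one_mem_curve _)

theorem mem_interior_filled_of_mem_triangle {x : ℕ → ℕ} (hx : ∀ i, 1 ≤ x i) {z : ℂ}
    (hz : z ∈ triangle) (hzc : z ∉ curve x) (h1 : cu z < 1) (h2 : 0 < cu z + cv z) :
    z ∈ interior (filled x) := by
  rcases hz.1.lt_or_eq with hv | hv
  · refine mem_interior.2 ⟨{z | cv z < 0 ∧ cu z < 1 ∧ 0 < cu z + cv z}, ?_, ?_, hv, h1, h2⟩
    · rintro w ⟨hw1, hw2, hw3⟩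
      exact triangle_subset_filled x ⟨hw1.le, hw2.le, hw3.le⟩
    · exact (isOpen_lt (by fun_prop) (by fun_prop)).and <|
        (isOpen_lt (by fun_prop) (by fun_prop)).and (isOpen_lt (by fun_prop) (by fun_prop))
  · have hs : z = (cu z : ℂ) := ext_coords (by simp) (by simpa using hv)
    rw [hs] at hzc ⊢
    exact mem_interior_filled_of_real hx (by linarith) h1.le hzc

/-- Points of the filled region that are neither on the curve nor on the two lower sides of the
triangle are interior. -/
theorem mem_interior_filled_of_mem_fill (n : ℕ) : ∀ {x : ℕ → ℕ}, (∀ i, 1 ≤ x i) → ∀ {z : ℂ},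
    z ∈ fill n x → z ∉ curve x → (z ∈ triangle → cu z < 1 ∧ 0 < cu z + cv z) →
      z ∈ interior (filled x) := by
  induction n with
  | zero =>
    intro x hx z hz hzc h
    exact mem_interior_filled_of_mem_triangle hx hz hzc (h hz).1 (h hz).2
  | succ n ih =>
    intro x hx z hz hzc h
    by_cases hzt : z ∈ triangle
    · exact mem_interior_filled_of_mem_triangle hx hzt hzc (h hzt).1 (h hzt).2
    obtain hz | ⟨j, hj, w, hw, rfl⟩ := mem_fill_succ.1 hz
    · exact absurd hz hzt
    have hsx : ∀ i, 1 ≤ shift x i := fun i => hx _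
    have hwc : w ∉ curve (shift x) := fun hc => hzc (sim_mem_curve hj hc)
    by_cases hcase : w ∈ triangle → cu w < 1 ∧ 0 < cu w + cv w
    · exact sim_mem_interior_filled hj (ih hsx hw hwc hcase)
    push Not at hcase
    obtain ⟨⟨hv, hu1, huv⟩, hside⟩ := hcase
    have hside' : cu w = 1 ∨ cu w + cv w = 0 := by
      rcases hu1.lt_or_eq with h' | h'
      · exact Or.inr (le_antisymm (hside h') huv)
      · exact Or.inl h'
    have hl := ell_pos (x 0)
    have el := ell_cast (x 0)
    -- What remains is `w` on a lower side of its triangle. For a side of a spike, one lower side is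
    -- the base of the spike, which lies in the big triangle, and the other is the opposite side of
    -- the same spike, where the image is also that of a real number and the base segment result
    -- applies.
    have real_case : ∀ (i : ℕ) (t : ℝ), i < m (x 0) → 0 ≤ t → t ≤ 1 →
        sim (x 0) i t = sim (x 0) j w → sim (x 0) j w ∈ interior (filled x) := by
      intro i t hi h0 h1 e
      rw [← e] at hzc ⊢
      exact sim_mem_interior_filled hi
        (mem_interior_filled_of_real hsx h0 h1 fun hc => hzc (sim_mem_curve hi hc))
    rcases index_cases hj with ⟨k, hk, rfl⟩ | ⟨k, hk, rfl⟩ | ⟨k, hk, rfl⟩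
    · refine absurd ⟨?_, ?_, ?_⟩ hzt <;> refine le_of_mul_le_mul_left ?_ hl <;>
      linarith [cu_sim_flat (x 0) k w, cv_sim_flat (x 0) k w, (Nat.cast_le (α := ℝ)).2 hk,
        (Nat.cast_nonneg k : (0 : ℝ) ≤ k)]
    · have e1 := cu_sim_up (x 0) k w
      have e2 := cv_sim_up (x 0) k w
      have hk' : (k : ℝ) + 1 ≤ x 0 := by exact_mod_cast hk
      have hk0 : (0 : ℝ) ≤ k := by positivity
      rcases hside' with hs | hs
      · refine real_case (3 * k + 2) (-cv w) (by rw [m]; omega) (by linarith) (by linarith) ?_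
        have e3 := cu_sim_down (x 0) k ((-cv w : ℝ) : ℂ)
        have e4 := cv_sim_down (x 0) k ((-cv w : ℝ) : ℂ)
        rw [cu_ofReal, cv_ofReal] at e3
        rw [cu_ofReal] at e4
        apply ext_coords <;> exact mul_left_cancel₀ hl.ne' (by linarith)
      · refine absurd ⟨?_, ?_, ?_⟩ hzt <;> refine le_of_mul_le_mul_left ?_ hl <;> linarith
    · have e1 := cu_sim_down (x 0) k w
      have e2 := cv_sim_down (x 0) k w
      have hk' : (k : ℝ) + 1 ≤ x 0 := by exact_mod_cast hk
      have hk0 : (0 : ℝ) ≤ k := by positivity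
      rcases hside' with hs | hs
      · refine absurd ⟨?_, ?_, ?_⟩ hzt <;> refine le_of_mul_le_mul_left ?_ hl <;> linarith
      · refine real_case (3 * k + 1) (1 - cu w) (by rw [m]; omega) (by linarith) (by linarith) ?_
        have e3 := cu_sim_up (x 0) k ((1 - cu w : ℝ) : ℂ)
        have e4 := cv_sim_up (x 0) k ((1 - cu w : ℝ) : ℂ)
        rw [cv_ofReal] at e3
        rw [cu_ofReal, cv_ofReal] at e4
        apply ext_coords <;> exact mul_left_cancel₀ hl.ne' (by linarith)

/-! ### The filled region is compact -/

theorem isClosed_fill (n : ℕ) : ∀ x, IsClosed (fill n x) := by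
  have hc : IsCompact triangle :=
    (isCompact_closedBall 0 1).of_isClosed_subset isClosed_triangle triangle_subset_closedBall
  suffices h : ∀ x, IsCompact (fill n x) from fun x => (h x).isClosed
  induction n with
  | zero => exact fun _ => hc
  | succ n ih =>
    exact fun x => hc.union
      ((Finset.range _).isCompact_biUnion fun j _ => (ih _).image (continuous_sim _ j))

theorem fill_subset_closedBall (n : ℕ) : ∀ {x : ℕ → ℕ}, (∀ i, 1 ≤ x i) →
    fill n x ⊆ Metric.closedBall 0 2 := by
  have ht : triangle ⊆ Metric.closedBall 0 2 :=
    triangle_subset_closedBall.trans (Metric.closedBall_subset_closedBall (by norm_num))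
  induction n with
  | zero => exact fun _ => ht
  | succ n ih =>
    intro x hx z hz
    obtain hz | ⟨j, hj, w, hw, rfl⟩ := mem_fill_succ.1 hz
    · exact ht hz
    -- The radius 2 reproduces itself, since `1 + 2 / 3 ≤ 2`.
    · have h1 := closedRhombus_subset_closedBall
        (sim_image_closedRhombus hj (mem_image_of_mem _ zero_mem_closedRhombus))
      have h2 := ih (fun i => hx (i + 1)) hw
      have h3 := three_le_ell (hx 0)
      have h4 := ell_mul_dist_sim (x 0) j w 0
      rw [Metric.mem_closedBall] at h1 h2 ⊢
      have h5 := dist_triangle (sim (x 0) j w) (sim (x 0) j 0) 0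
      nlinarith [dist_nonneg (x := sim (x 0) j w) (y := sim (x 0) j 0)]

/-- Points added after step `n` lie in copies, scaled by `1 / scale n x`, of a region within
distance 2 of the point `0` of its curve. Thus, away from the curve, `filled` coincides with a
closed set `fill n x`, which makes it closed. -/
theorem fill_subset_fill_or_near (n : ℕ) : ∀ (k : ℕ) {x : ℕ → ℕ}, (∀ i, 1 ≤ x i) → ∀ z ∈ fill k x,
    z ∈ fill n x ∨ scale n x * Metric.infDist z (curve x) ≤ 2 := by
  induction n with
  | zero =>
    intro k x hx z hz
    right
    rw [scale_zero, one_mul]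
    exact (Metric.infDist_le_dist_of_mem (zero_mem_curve x)).trans (fill_subset_closedBall k hx hz)
  | succ n ih =>
    intro k x hx z hz
    cases k with
    | zero => exact Or.inl (triangle_subset_fill _ _ hz)
    | succ k =>
      obtain hz | ⟨j, hj, w, hw, rfl⟩ := mem_fill_succ.1 hz
      · exact Or.inl (triangle_subset_fill _ _ hz)
      · rcases ih k (fun i => hx (i + 1)) w hw with h | h
        · exact Or.inl (mem_fill_succ.2 (Or.inr ⟨j, hj, w, h, rfl⟩))
        · right
          rw [scale_succ, mul_comm (ell (x 0) : ℝ), mul_assoc]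
          exact (mul_le_mul_of_nonneg_left (ell_mul_infDist_sim_le hj w) (scale_pos _ _).le).trans h

theorem isClosed_filled {x : ℕ → ℕ} (hx : ∀ i, 1 ≤ x i) : IsClosed (filled x) := by
  refine isClosed_of_closure_subset fun z hz => ?_
  by_contra hzn
  have hzc : z ∉ curve x := fun h => hzn (curve_subset_filled x h)
  have hpos := ((isClosed_curve x).notMem_iff_infDist_pos ⟨0, zero_mem_curve x⟩).1 hzc
  obtain ⟨n, hn⟩ := pow_unbounded_of_one_lt (2 / Metric.infDist z (curve x))
    (by norm_num : (1 : ℝ) < 3)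
  have hcl : IsClosed (fill n x ∪ {z | scale n x * Metric.infDist z (curve x) ≤ 2}) :=
    (isClosed_fill n x).union (isClosed_le
      (continuous_const.mul (Metric.continuous_infDist_pt _)) continuous_const)
  have hsub : filled x ⊆ fill n x ∪ {z | scale n x * Metric.infDist z (curve x) ≤ 2} := by
    rintro w (hw | hw)
    · right
      rw [mem_ofPred_eq, Metric.infDist_zero_of_mem hw]
      norm_num
    · obtain ⟨k, hk⟩ := mem_iUnion.1 hw
      exact fill_subset_fill_or_near n k hx w hk
  rcases closure_minimal hsub hcl hz with h | h
  · exact hzn (fill_subset_filled n x h)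
  · rw [mem_ofPred_eq] at h
    rw [div_lt_iff₀ hpos] at hn
    nlinarith [three_pow_le_scale hx n]

theorem isBounded_filled {x : ℕ → ℕ} (hx : ∀ i, 1 ≤ x i) : Bornology.IsBounded (filled x) := by
  refine (Metric.isBounded_closedBall (x := (0 : ℂ)) (r := 2)).subset (union_subset ?_ ?_)
  · exact ((curve_subset_closedRhombus x).trans closedRhombus_subset_closedBall).trans
      (Metric.closedBall_subset_closedBall (by norm_num))
  · exact iUnion_subset fun n => fill_subset_closedBall n hx

/-! ### The domain enclosed by the closed curve -/

/-- The rotation about the centre of the triangle that permutes its vertices. -/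
def rot (z : ℂ) : ℂ := 1 + (apex - 1) * z

theorem apex_sub_one : apex - 1 = -omega := by rw [apex_eq]; ring

theorem cu_rot (z : ℂ) : cu (rot z) = 1 + cv z := by
  have : -omega * z = 0 - omega * z := by ring
  rw [rot, apex_sub_one, this, cu_add, cu_sub, cu_omega_mul, cu_one, cu_zero]; ring

theorem cv_rot (z : ℂ) : cv (rot z) = -(cu z + cv z) := by
  have : -omega * z = 0 - omega * z := by ring
  rw [rot, apex_sub_one, this, cv_add, cv_sub, cv_omega_mul, cv_one, cv_zero]; ring

theorem rot_rot_rot (z : ℂ) : rot (rot (rot z)) = z := by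
  apply ext_coords
  · simp only [cu_rot, cv_rot]; ring
  · simp only [cu_rot, cv_rot]; ring

theorem rot_rot (z : ℂ) : rot (rot z) = apex + (0 - apex) * z := by
  have : apex + (0 - apex) * z = apex - apex * z := by ring
  rw [this]
  apply ext_coords
  · rw [cu_rot, cv_rot, cu_sub, cu_apex_mul, cu_apex]; ring
  · rw [cv_rot, cu_rot, cv_rot, cv_sub, cv_apex_mul, cv_apex]; ring

theorem dist_rot (z w : ℂ) : dist (rot z) (rot w) = dist z w := by
  rw [dist_eq_norm, dist_eq_norm, rot, rot, add_sub_add_left_eq_sub, ← mul_sub, norm_mul,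
    apex_sub_one, norm_neg, norm_omega, one_mul]

theorem continuous_rot : Continuous rot := by unfold rot; fun_prop

/-- The rotation `rot` as a homeomorphism. -/
def rotHomeo : ℂ ≃ₜ ℂ where
  toFun := rot
  invFun z := rot (rot z)
  left_inv := rot_rot_rot
  right_inv := rot_rot_rot
  continuous_toFun := continuous_rot
  continuous_invFun := continuous_rot.comp continuous_rot

/-- The union of the three rotated copies of a set. -/
def threeCopies (S : Set ℂ) : Set ℂ := S ∪ rot '' S ∪ rot '' (rot '' S)

theorem closedCurve_eq (x : ℕ → ℕ) : closedCurve x = threeCopies (curve x) := by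
  rw [closedCurve, threeCopies, image_image rot rot]
  simp only [rot_rot]
  rfl

theorem subset_threeCopies (S : Set ℂ) : S ⊆ threeCopies S :=
  subset_union_left.trans subset_union_left

theorem rot_image_threeCopies (S : Set ℂ) : rot '' threeCopies S ⊆ threeCopies S := by
  rw [threeCopies, image_union, image_union]
  refine union_subset (union_subset ?_ ?_) ?_
  · exact subset_union_right.trans subset_union_left
  · exact subset_union_right
  · rw [image_image, image_image]
    simp only [rot_rot_rot, image_id']
    exact subset_union_left.trans subset_union_left

theorem isClosed_threeCopies {S : Set ℂ} (hS : IsClosed S) : IsClosed (threeCopies S) :=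
  (hS.union (rotHomeo.isClosedMap _ hS)).union
    (rotHomeo.isClosedMap _ (rotHomeo.isClosedMap _ hS))

theorem isClosed_closedCurve (x : ℕ → ℕ) : IsClosed (closedCurve x) := by
  rw [closedCurve_eq]
  exact isClosed_threeCopies (isClosed_curve x)

theorem curve_subset_closedCurve (x : ℕ → ℕ) : curve x ⊆ closedCurve x := by
  rw [closedCurve_eq]
  exact subset_threeCopies _

theorem rot_mem_interior_threeCopies {S : Set ℂ} {z : ℂ} (hz : z ∈ interior (threeCopies S)) :
    rot z ∈ interior (threeCopies S) :=
  interior_mono (rot_image_threeCopies S)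
    (rotHomeo.isOpenMap.image_interior_subset _ (mem_image_of_mem _ hz))

/-- The points not covered by the local analysis lie on the two lower sides of the triangle. Those
sides are the images of `[0,1]` under `rot` and its square, so the result for the base segment
applies to the rotated copies. -/
theorem mem_interior_of_mem_filled {x : ℕ → ℕ} (hx : ∀ i, 1 ≤ x i) {z : ℂ} (hz : z ∈ filled x)
    (hzc : z ∉ closedCurve x) : z ∈ interior (threeCopies (filled x)) := by
  have hzc' : z ∉ curve x := fun h => hzc (curve_subset_closedCurve x h)
  have hmono := interior_mono (subset_threeCopies (filled x))
  rw [closedCurve_eq] at hzc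
  obtain ⟨n, hn⟩ := mem_iUnion.1 (hz.resolve_left hzc')
  by_cases hcase : z ∈ triangle → cu z < 1 ∧ 0 < cu z + cv z
  · exact hmono (mem_interior_filled_of_mem_fill n hx hn hzc' hcase)
  push Not at hcase
  obtain ⟨⟨hv, hu1, huv⟩, hside⟩ := hcase
  rcases hu1.lt_or_eq with h' | h'
  · have h0 := le_antisymm (hside h') huv
    have e : rot (rot ((1 - cu z : ℝ) : ℂ)) = z := by
      apply ext_coords
      · rw [cu_rot, cv_rot, cu_ofReal, cv_ofReal]; ring
      · rw [cv_rot, cu_rot, cv_rot, cu_ofReal, cv_ofReal]; linarith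
    rw [← e] at hzc ⊢
    refine rot_mem_interior_threeCopies (rot_mem_interior_threeCopies (hmono
      (mem_interior_filled_of_real hx (by linarith) (by linarith) fun hc => hzc ?_)))
    exact Or.inr (mem_image_of_mem _ (mem_image_of_mem _ hc))
  · have e : rot ((-cv z : ℝ) : ℂ) = z := by
      apply ext_coords
      · rw [cu_rot, cv_ofReal, h']; ring
      · rw [cv_rot, cu_ofReal, cv_ofReal]; ring
    rw [← e] at hzc ⊢
    refine rot_mem_interior_threeCopies (hmono
      (mem_interior_filled_of_real hx (by linarith) (by linarith) fun hc => hzc ?_))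
    exact Or.inl (Or.inr (mem_image_of_mem _ hc))

theorem threeCopies_filled_diff_subset_interior {x : ℕ → ℕ} (hx : ∀ i, 1 ≤ x i) :
    threeCopies (filled x) \ closedCurve x ⊆ interior (threeCopies (filled x)) := by
  have hrot : ∀ z, rot z ∉ closedCurve x → z ∉ closedCurve x := by
    intro z hz h
    rw [closedCurve_eq] at hz h
    exact hz (rot_image_threeCopies _ (mem_image_of_mem _ h))
  rintro z ⟨(hz | ⟨w, hw, rfl⟩) | ⟨_, ⟨w, hw, rfl⟩, rfl⟩, hzc⟩
  · exact mem_interior_of_mem_filled hx hz hzc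
  · exact rot_mem_interior_threeCopies (mem_interior_of_mem_filled hx hw (hrot _ hzc))
  · exact rot_mem_interior_threeCopies (rot_mem_interior_threeCopies
      (mem_interior_of_mem_filled hx hw (hrot _ (hrot _ hzc))))

/-- The filled region off the curve is enclosed by the curve. -/
theorem filled_diff_subset_domain {x : ℕ → ℕ} (hx : ∀ i, 1 ≤ x i) :
    filled x \ closedCurve x ⊆ domain x := by
  rintro z ⟨hz, hzc⟩
  have hFc : IsClosed (threeCopies (filled x)) := isClosed_threeCopies (isClosed_filled hx)
  -- This set is open, and closed relative to the complement of the curve, so a component of that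
  -- complement meeting it stays inside it and is bounded.
  have hopen : IsOpen (threeCopies (filled x) \ closedCurve x) := by
    have : threeCopies (filled x) \ closedCurve x
        = interior (threeCopies (filled x)) \ closedCurve x :=
      subset_antisymm (fun w hw => ⟨threeCopies_filled_diff_subset_interior hx hw, hw.2⟩)
        (sdiff_subset_sdiff_left interior_subset)
    rw [this]
    exact isOpen_interior.sdiff (isClosed_closedCurve x)
  refine ⟨hzc, ?_⟩
  have hsub : connectedComponentIn (closedCurve x)ᶜ z ⊆ threeCopies (filled x) \ closedCurve x := by
    refine isPreconnected_connectedComponentIn.subset_of_closure_inter_subset hopen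
      ⟨z, mem_connectedComponentIn hzc, subset_threeCopies _ hz, hzc⟩ ?_
    rintro w ⟨hw, hwc⟩
    exact ⟨closure_minimal sdiff_subset hFc hw, connectedComponentIn_subset _ _ hwc⟩
  have hb := isBounded_filled hx
  have hrot : ∀ {S : Set ℂ}, Bornology.IsBounded S → Bornology.IsBounded (rot '' S) := fun h =>
    (LipschitzWith.of_dist_le_mul (K := 1) fun z w => by
      rw [dist_rot, NNReal.coe_one, one_mul]).isBounded_image h
  exact ((hb.union (hrot hb)).union (hrot (hrot hb))).subset (hsub.trans sdiff_subset)

/-- Components of the complement of the curve are open, and each is either contained in the domain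
or disjoint from it. -/
theorem frontier_domain_subset (x : ℕ → ℕ) : frontier (domain x) ⊆ closedCurve x := by
  rintro z ⟨hzc, hzi⟩
  by_contra hz
  have hC : IsOpen (connectedComponentIn (closedCurve x)ᶜ z) :=
    (isClosed_closedCurve x).isOpen_compl.connectedComponentIn
  obtain ⟨y, hy, hyd⟩ := mem_closure_iff.1 hzc _ hC (mem_connectedComponentIn hz)
  have hb := hyd.2
  rw [← connectedComponentIn_eq hy] at hb
  have hsub : connectedComponentIn (closedCurve x)ᶜ z ⊆ domain x := fun w hw =>
    ⟨connectedComponentIn_subset _ _ hw, by rwa [← connectedComponentIn_eq hw]⟩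
  exact hzi (mem_interior.2 ⟨_, hsub, hC, mem_connectedComponentIn hz⟩)

theorem mem_frontier_domain {x : ℕ → ℕ} {z : ℂ} (hz : z ∈ closedCurve x)
    (hz' : z ∈ closure (domain x)) : z ∈ frontier (domain x) :=
  ⟨hz', fun h => (interior_subset h).1 hz⟩

/-! ### Areas -/

theorem volume_iter_le (B : Set ℂ) (n : ℕ) : ∀ x,
    volume (iter B n x) ≤ ENNReal.ofReal (count n x / scale n x ^ 2) * volume B := by
  induction n with
  | zero => intro x; simp [iter]
  | succ n ih =>
    intro x
    refine (measure_biUnion_finset_le _ _).trans ?_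
    have h : ∀ j ∈ Finset.range (m (x 0)), volume (sim (x 0) j '' iter B n (shift x)) ≤
        ENNReal.ofReal (((ell (x 0) : ℝ) ^ 2)⁻¹) *
          (ENNReal.ofReal (count n (shift x) / scale n (shift x) ^ 2) * volume B) := by
      intro j _
      rw [volume_sim_image]
      gcongr
      exact ih _
    refine (Finset.sum_le_card_nsmul _ _ _ h).trans (le_of_eq ?_)
    rw [Finset.card_range, nsmul_eq_mul, ← mul_assoc, ← mul_assoc, ← ENNReal.ofReal_natCast,
      ← ENNReal.ofReal_mul (by positivity), ← ENNReal.ofReal_mul (by positivity), count_succ,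
      scale_succ]
    congr 2
    have := (ell_pos (x 0)).ne'
    have := (scale_pos n (shift x)).ne'
    field_simp

/-- Areas of the images add up exactly, by the disjointness in the open set condition. -/
theorem le_volume_iter {B : Set ℂ} (hB : IsOpen B) (hBr : B ⊆ rhombus) (n : ℕ) : ∀ x,
    ENNReal.ofReal (count n x / scale n x ^ 2) * volume B ≤ volume (iter B n x) := by
  induction n with
  | zero => intro x; simp [iter]
  | succ n ih =>
    intro x
    have hsub : iter B n (shift x) ⊆ rhombus :=
      iter_subset_of_invariant hBr (fun _ _ => sim_image_rhombus) n _
    rw [iter, measure_biUnion_finset (fun i _ j _ hij =>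
        (sim_rhombus_disjoint (x 0) hij).mono (image_mono hsub) (image_mono hsub))
      (fun j _ => (isOpenMap_sim _ j _ (isOpen_iter hB n _)).measurableSet)]
    have h : ∀ j ∈ Finset.range (m (x 0)), ENNReal.ofReal (((ell (x 0) : ℝ) ^ 2)⁻¹) *
          (ENNReal.ofReal (count n (shift x) / scale n (shift x) ^ 2) * volume B) ≤
        volume (sim (x 0) j '' iter B n (shift x)) := by
      intro j _
      rw [volume_sim_image]
      gcongr
      exact ih _
    refine le_trans (le_of_eq ?_) (Finset.card_nsmul_le_sum _ _ _ h)
    rw [Finset.card_range, nsmul_eq_mul, ← mul_assoc, ← mul_assoc, ← ENNReal.ofReal_natCast,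
      ← ENNReal.ofReal_mul (by positivity), ← ENNReal.ofReal_mul (by positivity), count_succ,
      scale_succ]
    congr 2
    have := (ell_pos (x 0)).ne'
    have := (scale_pos n (shift x)).ne'
    field_simp

theorem count_div_scale_sq_le {x : ℕ → ℕ} (hx : ∀ i, 1 ≤ x i) (n : ℕ) :
    count n x / scale n x ^ 2 ≤ (4 / 9) ^ n := by
  rw [count, scale, ← Finset.prod_pow, ← Finset.prod_div_distrib]
  refine (Finset.prod_le_prod (fun i _ => by positivity) (g := fun _ => (4 / 9 : ℝ))
    fun i _ => ?_).trans_eq (by rw [Finset.prod_const, Finset.card_range])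
  have h : (1 : ℝ) ≤ x i := by exact_mod_cast hx i
  rw [ell_cast, m, div_le_div_iff₀ (by positivity) (by norm_num)]
  push_cast
  -- Cross-multiplied, `(3 * a + 1) / (2 * a + 1) ^ 2 ≤ 4 / 9` reads `0 ≤ (a - 1) * (16 * a + 5)`.
  nlinarith [mul_nonneg (sub_nonneg.2 h) (by linarith : (0 : ℝ) ≤ 16 * x i + 5)]

theorem volume_closedRhombus_lt_top : volume closedRhombus < ⊤ :=
  (measure_mono closedRhombus_subset_closedBall).trans_lt measure_closedBall_lt_top

theorem volume_curve {x : ℕ → ℕ} (hx : ∀ i, 1 ≤ x i) : volume (curve x) = 0 := by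
  have hlim : Tendsto (fun n : ℕ => ENNReal.ofReal ((4 / 9) ^ n) * volume closedRhombus) atTop
      (𝓝 (ENNReal.ofReal 0 * volume closedRhombus)) :=
    ENNReal.Tendsto.mul_const (ENNReal.tendsto_ofReal
      (tendsto_pow_atTop_nhds_zero_of_lt_one (by norm_num) (by norm_num)))
      (Or.inr volume_closedRhombus_lt_top.ne)
  rw [ENNReal.ofReal_zero, zero_mul] at hlim
  refine le_antisymm (ge_of_tendsto' hlim fun n => ?_) zero_le
  refine (measure_mono (curve_subset_iter n x)).trans ((volume_iter_le _ n x).trans ?_)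
  gcongr
  exact count_div_scale_sq_le hx n

theorem volume_closedCurve {x : ℕ → ℕ} (hx : ∀ i, 1 ≤ x i) : volume (closedCurve x) = 0 := by
  have hrot : ∀ {S : Set ℂ}, volume S = 0 → volume (rot '' S) = 0 := by
    intro S hS
    refine addHaar_image_eq_zero_of_differentiableOn_of_addHaar_eq_zero _ ?_ hS
    unfold rot
    fun_prop
  have h := volume_curve hx
  rw [closedCurve_eq, threeCopies, measure_union_null_iff, measure_union_null_iff]
  exact ⟨⟨h, hrot h⟩, hrot (hrot h)⟩

/-! ### The boundary of the domain -/

theorem iter_triangle_subset_fill (n : ℕ) : ∀ x, iter triangle n x ⊆ fill n x := by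
  induction n with
  | zero => exact fun _ => subset_rfl
  | succ n ih =>
    exact fun x => (iUnion₂_mono fun j _ => image_mono (ih (shift x))).trans subset_union_right

theorem iter_lowerRhombus_subset_filled (n : ℕ) (x : ℕ → ℕ) : iter lowerRhombus n x ⊆ filled x :=
  (iter_mono lowerRhombus_subset_triangle n x).trans
    ((iter_triangle_subset_fill n x).trans (fill_subset_filled n x))

theorem lowerRhombus_subset_closedBall : lowerRhombus ⊆ Metric.closedBall 0 1 :=
  lowerRhombus_subset_triangle.trans triangle_subset_closedBall

theorem exists_open_near (n : ℕ) : ∀ {x : ℕ → ℕ}, ∀ z ∈ iter closedRhombus n x,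
    ∃ O : Set ℂ, IsOpen O ∧ O.Nonempty ∧ O ⊆ iter lowerRhombus n x ∧
      ∀ y ∈ O, scale n x * dist z y ≤ 2 := by
  induction n with
  | zero =>
    intro x z hz
    refine ⟨lowerRhombus, isOpen_lowerRhombus, lowerRhombus_nonempty, subset_rfl, fun y hy => ?_⟩
    have h1 := mem_closedBall_zero_iff.1 (closedRhombus_subset_closedBall hz)
    have h2 := mem_closedBall_zero_iff.1 (lowerRhombus_subset_closedBall hy)
    rw [scale_zero, one_mul]
    linarith [dist_le_norm_add_norm z y]
  | succ n ih =>
    intro x z hz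
    obtain ⟨j, hj, w, hw, rfl⟩ := mem_iter_succ.1 hz
    obtain ⟨O, hO, hne, hsub, hd⟩ := ih w hw
    refine ⟨sim (x 0) j '' O, isOpenMap_sim _ j _ hO, hne.image _, ?_, ?_⟩
    · rintro _ ⟨y, hy, rfl⟩
      exact mem_iter_succ.2 ⟨j, hj, y, hsub hy, rfl⟩
    · rintro _ ⟨y, hy, rfl⟩
      rw [scale_succ, mul_comm (ell (x 0) : ℝ), mul_assoc, ell_mul_dist_sim]
      exact hd y hy

/-- Arbitrarily close to a point of the curve there is a nonempty open part of `filled`; having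
positive area, it is not contained in the null set `closedCurve x`. -/
theorem curve_subset_closure_domain {x : ℕ → ℕ} (hx : ∀ i, 1 ≤ x i) :
    curve x ⊆ closure (domain x) := by
  intro z hz
  rw [Metric.mem_closure_iff]
  intro ε hε
  obtain ⟨n, hn⟩ := pow_unbounded_of_one_lt (2 / ε) (by norm_num : (1 : ℝ) < 3)
  obtain ⟨O, hO, hne, hsub, hd⟩ := exists_open_near n z (curve_subset_iter n x hz)
  have hpos : volume (closedCurve x) < volume O := by
    rw [volume_closedCurve hx]
    exact hO.measure_pos _ hne
  obtain ⟨y, hy, hyc⟩ := not_subset.1 fun h => (measure_mono h).not_gt hpos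
  refine ⟨y, filled_diff_subset_domain hx
    ⟨iter_lowerRhombus_subset_filled n x (hsub hy), hyc⟩, ?_⟩
  have h1 := hd y hy
  have h2 := three_pow_le_scale hx n
  rw [div_lt_iff₀ hε] at hn
  by_contra! hcon
  nlinarith [mul_le_mul h2 hcon hε.le (scale_pos n x).le]

theorem curve_subset_frontier_domain {x : ℕ → ℕ} (hx : ∀ i, 1 ≤ x i) :
    curve x ⊆ frontier (domain x) := fun _ hz =>
  mem_frontier_domain (curve_subset_closedCurve x hz) (curve_subset_closure_domain hx hz)

/-! ### Tubular neighbourhoods -/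

/-- The lower rhombi of level `n` have disjoint interiors, lie in the domain up to a null set, and
are within `1 / scale n x` of starting points of segments, which are boundary points. -/
theorem le_innerVol {x : ℕ → ℕ} (hx : ∀ i, 1 ≤ x i) {n : ℕ} {ε : ℝ} (hε : (scale n x)⁻¹ ≤ ε) :
    ENNReal.ofReal (count n x / scale n x ^ 2) * volume lowerRhombus ≤
      innerVol (domain x) ε := by
  refine (le_volume_iter isOpen_lowerRhombus lowerRhombus_subset_rhombus n x).trans ?_
  rw [← measure_sdiff_null (s := iter lowerRhombus n x) (volume_closedCurve hx)]
  refine measure_mono ?_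
  rintro z ⟨hz, hzc⟩
  refine ⟨?_, filled_diff_subset_domain hx ⟨iter_lowerRhombus_subset_filled n x hz, hzc⟩⟩
  obtain ⟨F, -, hF, hcov⟩ := exists_cover lowerRhombus_subset_closedBall n x
  obtain ⟨c, hc, hzc⟩ := mem_iUnion₂.1 (hcov hz)
  exact Metric.mem_cthickening_of_dist_le z c ε _
    (curve_subset_frontier_domain hx (iter_zero_subset_curve n x (hF hc)))
    ((Metric.mem_closedBall.1 hzc).trans hε)

theorem exists_cover_closedCurve (n : ℕ) (x : ℕ → ℕ) : ∃ F : Finset ℂ,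
    (F.card : ℝ) ≤ 3 * count n x ∧
      closedCurve x ⊆ ⋃ c ∈ F, Metric.closedBall c (scale n x)⁻¹ := by
  classical
  obtain ⟨F, hF, -, hcov⟩ := exists_cover closedRhombus_subset_closedBall n x
  have hrot : ∀ {S : Set ℂ} {F : Finset ℂ} {r : ℝ}, S ⊆ ⋃ c ∈ F, Metric.closedBall c r →
      rot '' S ⊆ ⋃ c ∈ F.image rot, Metric.closedBall c r := by
    rintro S F r h _ ⟨z, hz, rfl⟩
    obtain ⟨c, hc, hzc⟩ := mem_iUnion₂.1 (h hz)
    exact mem_iUnion₂.2 ⟨rot c, Finset.mem_image_of_mem _ hc, by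
      rwa [Metric.mem_closedBall, dist_rot]⟩
  have h0 := (curve_subset_iter n x).trans hcov
  refine ⟨F ∪ F.image rot ∪ (F.image rot).image rot, ?_, ?_⟩
  · have h1 : (F.image rot).card ≤ F.card := Finset.card_image_le
    have h2 : ((F.image rot).image rot).card ≤ F.card := Finset.card_image_le.trans h1
    have h3 := Finset.card_union_le (F ∪ F.image rot) ((F.image rot).image rot)
    have h4 := Finset.card_union_le F (F.image rot)
    have h5 : (F ∪ F.image rot ∪ (F.image rot).image rot).card ≤ 3 * F.card := by omega
    have h6 : ((F ∪ F.image rot ∪ (F.image rot).image rot).card : ℝ) ≤ 3 * F.card := by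
      exact_mod_cast h5
    linarith
  · rw [closedCurve_eq, threeCopies, Finset.set_biUnion_union, Finset.set_biUnion_union]
    exact union_subset_union (union_subset_union h0 (hrot h0)) (hrot (hrot h0))

theorem volume_cthickening_le {x : ℕ → ℕ} {K : Set ℂ} (hK : K ⊆ closedCurve x) {n : ℕ} {ε : ℝ}
    (hε0 : 0 < ε) (hε : (scale n x)⁻¹ ≤ ε) :
    volume (Metric.cthickening ε K) ≤ ENNReal.ofReal (27 * Real.pi * count n x * ε ^ 2) := by
  obtain ⟨F, hF, hcov⟩ := exists_cover_closedCurve n x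
  -- Less than `2 * ε` to a point of `K`, then at most `ε` to a centre. The constant 27 is 3 copies
  -- times `3 ^ 2`.
  have hsub : Metric.cthickening ε K ⊆ ⋃ c ∈ F, Metric.closedBall c (3 * ε) := by
    intro z hz
    have hz' := Metric.cthickening_subset_thickening' (by positivity) (by linarith : ε < 2 * ε) K hz
    obtain ⟨y, hy, hzy⟩ := Metric.mem_thickening_iff.1 hz'
    obtain ⟨c, hc, hyc⟩ := mem_iUnion₂.1 (hcov (hK hy))
    refine mem_iUnion₂.2 ⟨c, hc, ?_⟩
    rw [Metric.mem_closedBall] at hyc ⊢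
    linarith [dist_triangle z y c]
  refine (measure_mono hsub).trans ((measure_biUnion_finset_le _ _).trans ?_)
  have hvol : ∀ c ∈ F, volume (Metric.closedBall c (3 * ε)) ≤
      ENNReal.ofReal (9 * Real.pi * ε ^ 2) := by
    intro c _
    rw [Complex.volume_closedBall, ← ENNReal.ofReal_coe_nnreal,
      ← ENNReal.ofReal_pow (by positivity), ← ENNReal.ofReal_mul (by positivity), NNReal.coe_real_pi]
    refine ENNReal.ofReal_le_ofReal (le_of_eq ?_)
    ring
  refine (Finset.sum_le_card_nsmul _ _ _ hvol).trans ?_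
  rw [nsmul_eq_mul, ← ENNReal.ofReal_natCast, ← ENNReal.ofReal_mul (by positivity)]
  refine ENNReal.ofReal_le_ofReal ?_
  have : 0 ≤ 9 * Real.pi * ε ^ 2 := by positivity
  nlinarith [mul_le_mul_of_nonneg_right hF this]

/-! ### The natural measure on the curve -/

/-- The start of the segment of the `n`-th polygon that is reached at time `t ∈ [0,1)`, when all
segments are traversed in equal times. -/
def approx : ℕ → (ℕ → ℕ) → ℝ → ℂ
  | 0, _, _ => 0
  | n + 1, x, t => sim (x 0) ⌊m (x 0) * t⌋₊
      (approx n (shift x) (m (x 0) * t - ⌊m (x 0) * t⌋₊))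

theorem measurable_approx (n : ℕ) : ∀ x, Measurable (approx n x) := by
  induction n with
  | zero => exact fun _ => measurable_const
  | succ n ih =>
    intro x
    have h1 : Measurable fun t : ℝ => (m (x 0) : ℝ) * t := measurable_const_mul _
    have h2 : Measurable fun t : ℝ => ⌊m (x 0) * t⌋₊ := Nat.measurable_floor.comp h1
    have h3 : Measurable fun t : ℝ => ((⌊m (x 0) * t⌋₊ : ℕ) : ℝ) := measurable_from_nat.comp h2
    have h4 : Measurable fun t : ℝ => vertex (x 0) ⌊m (x 0) * t⌋₊ :=
      (measurable_from_nat (f := fun j => vertex (x 0) j)).comp h2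
    have h5 : Measurable fun t : ℝ => dir ⌊m (x 0) * t⌋₊ / (ell (x 0) : ℂ) :=
      (measurable_from_nat (f := fun j => dir j / (ell (x 0) : ℂ))).comp h2
    exact h4.add (h5.mul ((ih (shift x)).comp (h1.sub h3)))

theorem digit_bounds (a : ℕ) {t : ℝ} (ht : t ∈ Ico (0 : ℝ) 1) :
    ⌊m a * t⌋₊ < m a ∧ m a * t - ⌊m a * t⌋₊ ∈ Ico (0 : ℝ) 1 := by
  have hm : (0 : ℝ) < m a := by exact_mod_cast m_pos a
  have h0 : 0 ≤ m a * t := mul_nonneg hm.le ht.1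
  refine ⟨?_, ?_, ?_⟩
  · rw [Nat.floor_lt h0]
    nlinarith [ht.2]
  · linarith [Nat.floor_le h0]
  · linarith [Nat.lt_floor_add_one (m a * t)]

theorem approx_mem_curve (n : ℕ) : ∀ (x : ℕ → ℕ) {t : ℝ}, t ∈ Ico (0 : ℝ) 1 →
    approx n x t ∈ curve x := by
  induction n with
  | zero => exact fun x _ _ => zero_mem_curve x
  | succ n ih =>
    intro x t ht
    obtain ⟨h1, h2⟩ := digit_bounds (x 0) ht
    exact sim_mem_curve h1 (ih _ h2)

/-- Both points come from the same first `n` similarities, applied to `0` and to a point of a curve,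
which is in the unit ball. -/
theorem scale_mul_dist_approx (n k : ℕ) : ∀ (x : ℕ → ℕ) {t : ℝ}, t ∈ Ico (0 : ℝ) 1 →
    scale n x * dist (approx n x t) (approx (n + k) x t) ≤ 1 := by
  induction n with
  | zero =>
    intro x t ht
    rw [scale_zero, one_mul, zero_add, approx, dist_comm]
    exact closedRhombus_subset_closedBall (curve_subset_closedRhombus x (approx_mem_curve k x ht))
  | succ n ih =>
    intro x t ht
    rw [add_right_comm, approx, approx, scale_succ, mul_comm (ell (x 0) : ℝ), mul_assoc,
      ell_mul_dist_sim]
    exact ih _ (digit_bounds (x 0) ht).2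

/-- The curve has a measurable parametrization, uniformly approximated by `approx n x`. -/
theorem exists_parametrization {x : ℕ → ℕ} (hx : ∀ i, 1 ≤ x i) : ∃ γ : ℝ → ℂ, Measurable γ ∧
    ∀ t ∈ Ico (0 : ℝ) 1, γ t ∈ curve x ∧ ∀ n, dist (approx n x t) (γ t) ≤ (scale n x)⁻¹ := by
  have hd : ∀ n k, ∀ t ∈ Ico (0 : ℝ) 1,
      dist (approx n x t) (approx (n + k) x t) ≤ (scale n x)⁻¹ := by
    intro n k t ht
    rw [← one_div, le_div_iff₀ (scale_pos n x), mul_comm]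
    exact scale_mul_dist_approx n k x ht
  -- The fractional part extends the parametrization measurably to all of `ℝ` without changing it on
  -- `[0,1)`.
  have hlim : ∀ t : ℝ, ∃ z, Tendsto (fun n => approx n x (Int.fract t)) atTop (𝓝 z) := by
    intro t
    refine cauchySeq_tendsto_of_complete (cauchySeq_of_le_geometric (1 / 3) 1 (by norm_num) ?_)
    intro n
    refine (hd n 1 _ ⟨Int.fract_nonneg t, Int.fract_lt_one t⟩).trans ?_
    rw [one_mul, one_div, inv_pow]
    exact inv_anti₀ (by positivity) (three_pow_le_scale hx n)
  choose γ hγ using hlim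
  refine ⟨γ, measurable_of_tendsto_metrizable
    (fun n => (measurable_approx n x).comp measurable_fract) (tendsto_pi_nhds.2 hγ), ?_⟩
  intro t ht
  have h := hγ t
  rw [Int.fract_eq_self.2 ht] at h
  refine ⟨(isClosed_curve x).mem_of_tendsto h
    (Eventually.of_forall fun n => approx_mem_curve n x ht), fun n => ?_⟩
  refine le_of_tendsto (tendsto_const_nhds.dist h) ?_
  filter_upwards [eventually_ge_atTop n] with k hk
  obtain ⟨l, rfl⟩ := Nat.exists_eq_add_of_le hk
  exact hd n l t ht

theorem volume_image_digit (a j : ℕ) (S : Set ℝ) :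
    volume ((fun t : ℝ => (m a : ℝ)⁻¹ * (j + t)) '' S) =
      ENNReal.ofReal (m a : ℝ)⁻¹ * volume S := by
  have h : (fun t : ℝ => (m a : ℝ)⁻¹ * (j + t)) =
      (fun t => (m a : ℝ)⁻¹ • t) ∘ fun t => (j : ℝ) + t := rfl
  rw [h, image_comp, image_smul, Measure.addHaar_smul, Module.finrank_self, pow_one,
    abs_of_nonneg (by positivity), image_add_left, measure_preimage_add]

/-- The time spent in a ball is controlled by the area of the rhombi near it. -/
theorem volume_approx_mem_closedBall (n : ℕ) : ∀ (x : ℕ → ℕ) (y : ℂ) (r : ℝ),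
    volume {t ∈ Ico (0 : ℝ) 1 | approx n x t ∈ Metric.closedBall y r} *
        (ENNReal.ofReal (count n x / scale n x ^ 2) * volume rhombus) ≤
      volume (iter rhombus n x ∩ Metric.closedBall y (r + (scale n x)⁻¹)) := by
  induction n with
  | zero =>
    intro x y r
    by_cases h : (0 : ℂ) ∈ Metric.closedBall y r
    · have h1 : rhombus ⊆ Metric.closedBall y (r + 1) := by
        intro z hz
        have h2 := closedRhombus_subset_closedBall (rhombus_subset hz)
        rw [Metric.mem_closedBall] at h h2 ⊢
        linarith [dist_triangle z 0 y]
      have h3 : volume {t ∈ Ico (0 : ℝ) 1 | approx 0 x t ∈ Metric.closedBall y r} ≤ 1 := by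
        refine (measure_mono (sep_subset _ _)).trans ?_
        rw [Real.volume_Ico]; simp
      simp only [iter, count_zero, scale_zero, one_pow, div_one, ENNReal.ofReal_one, one_mul,
        inv_one, inter_eq_left.2 h1]
      exact mul_le_of_le_one_left' h3
    · simp [approx, h]
  | succ n ih =>
    intro x y r
    have hl := ell_pos (x 0)
    have hm : (0 : ℝ) < m (x 0) := by exact_mod_cast m_pos (x 0)
    have hs := scale_pos n (shift x)
    -- Pulled back by the `j`-th similarity, the ball around `y` becomes the ball around `c j` with
    -- radius multiplied by `ell`.
    choose c hc using fun j => sim_surjective (x 0) j y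
    let A : ℕ → Set ℝ := fun j =>
      {t ∈ Ico (0 : ℝ) 1 | approx n (shift x) t ∈ Metric.closedBall (c j) (ell (x 0) * r)}
    let S : ℕ → Set ℂ := fun j => iter rhombus n (shift x) ∩
      Metric.closedBall (c j) (ell (x 0) * r + (scale n (shift x))⁻¹)
    have hA : {t ∈ Ico (0 : ℝ) 1 | approx (n + 1) x t ∈ Metric.closedBall y r} ⊆
        ⋃ j ∈ Finset.range (m (x 0)), (fun t : ℝ => (m (x 0) : ℝ)⁻¹ * (j + t)) '' A j := by
      rintro t ⟨ht, hty⟩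
      obtain ⟨h1, h2⟩ := digit_bounds (x 0) ht
      refine mem_biUnion (Finset.mem_range.2 h1) ⟨_, ⟨h2, ?_⟩, ?_⟩
      · rwa [approx, ← hc ⌊m (x 0) * t⌋₊, ← sim_image_closedBall,
          (sim_injective _ _).mem_set_image] at hty
      · simp only
        field_simp
        ring
    have hvolA : volume {t ∈ Ico (0 : ℝ) 1 | approx (n + 1) x t ∈ Metric.closedBall y r} ≤
        ∑ j ∈ Finset.range (m (x 0)), ENNReal.ofReal (m (x 0) : ℝ)⁻¹ * volume (A j) := by
      refine (measure_mono hA).trans ((measure_biUnion_finset_le _ _).trans (le_of_eq ?_))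
      exact Finset.sum_congr rfl fun j _ => volume_image_digit _ _ _
    have hsub : iter rhombus n (shift x) ⊆ rhombus :=
      iter_subset_of_invariant subset_rfl (fun _ _ => sim_image_rhombus) n _
    have hS : (⋃ j ∈ Finset.range (m (x 0)), sim (x 0) j '' S j) ⊆
        iter rhombus (n + 1) x ∩ Metric.closedBall y (r + (scale (n + 1) x)⁻¹) := by
      refine iUnion₂_subset fun j hj => ?_
      rintro _ ⟨w, ⟨hw1, hw2⟩, rfl⟩
      refine ⟨mem_iter_succ.2 ⟨j, Finset.mem_range.1 hj, w, hw1, rfl⟩, ?_⟩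
      rw [← hc j, ← sim_image_closedBall, (sim_injective _ _).mem_set_image, scale_succ]
      convert hw2 using 2
      field_simp
    have hvolS : volume (⋃ j ∈ Finset.range (m (x 0)), sim (x 0) j '' S j) =
        ∑ j ∈ Finset.range (m (x 0)),
          ENNReal.ofReal (((ell (x 0) : ℝ) ^ 2)⁻¹) * volume (S j) := by
      rw [measure_biUnion_finset (fun i _ j _ hij => (sim_rhombus_disjoint (x 0) hij).mono
          (image_mono (inter_subset_left.trans hsub)) (image_mono (inter_subset_left.trans hsub)))
        (fun j _ => (simHomeo (x 0) j).measurableEmbedding.measurableSet_image.2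
          ((isOpen_iter isOpen_rhombus n _).measurableSet.inter
            Metric.isClosed_closedBall.measurableSet))]
      exact Finset.sum_congr rfl fun j _ => volume_sim_image _ _ _
    refine le_trans ?_ (measure_mono hS)
    rw [hvolS]
    refine (mul_le_mul_left hvolA _).trans ?_
    rw [Finset.sum_mul]
    refine Finset.sum_le_sum fun j _ => ?_
    refine le_trans (le_of_eq ?_) (mul_le_mul_right (ih (shift x) (c j) (ell (x 0) * r)) _)
    -- Each first digit takes a share `1 / m` of the time, and areas shrink by `1 / ell ^ 2`; the
    -- factor `count / scale ^ 2` balances the two.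
    have e : ENNReal.ofReal (m (x 0) : ℝ)⁻¹ *
        ENNReal.ofReal (count (n + 1) x / scale (n + 1) x ^ 2) =
        ENNReal.ofReal (((ell (x 0) : ℝ) ^ 2)⁻¹) *
          ENNReal.ofReal (count n (shift x) / scale n (shift x) ^ 2) := by
      rw [← ENNReal.ofReal_mul (by positivity), ← ENNReal.ofReal_mul (by positivity), count_succ,
        scale_succ]
      congr 1
      field_simp
    calc _ = ENNReal.ofReal (m (x 0) : ℝ)⁻¹ *
        ENNReal.ofReal (count (n + 1) x / scale (n + 1) x ^ 2) *
          (volume (A j) * volume rhombus) := by ring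
      _ = _ := by rw [e]; ring

/-- The curve carries a probability measure whose mass on balls is controlled by the number of
segments. -/
theorem exists_measure {x : ℕ → ℕ} (hx : ∀ i, 1 ≤ x i) : ∃ μ : Measure ℂ, μ (curve x) = 1 ∧
    ∀ (n : ℕ) (y : ℂ) (r : ℝ), (scale n x)⁻¹ ≤ r →
      μ (Metric.closedBall y r) * (ENNReal.ofReal (count n x / scale n x ^ 2) * volume rhombus) ≤
        ENNReal.ofReal (9 * Real.pi * r ^ 2) := by
  obtain ⟨γ, hγm, hγ⟩ := exists_parametrization hx
  refine ⟨(volume.restrict (Ico (0 : ℝ) 1)).map γ, ?_, ?_⟩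
  · rw [Measure.map_apply hγm (isClosed_curve x).measurableSet,
      Measure.restrict_apply (hγm (isClosed_curve x).measurableSet),
      inter_eq_right.2 (show Ico 0 1 ⊆ γ ⁻¹' curve x from fun t ht => (hγ t ht).1), Real.volume_Ico]
    simp
  · intro n y r hr
    have hr0 : 0 ≤ r := (inv_pos.2 (scale_pos n x)).le.trans hr
    rw [Measure.map_apply hγm Metric.isClosed_closedBall.measurableSet,
      Measure.restrict_apply (hγm Metric.isClosed_closedBall.measurableSet)]
    -- `γ` is within `1 / scale ≤ r` of its approximation, so the radius becomes `2 * r`, and a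
    -- small rhombus adds another `r`; the ball of radius `3 * r` has area `9 * π * r ^ 2`.
    have hsub : γ ⁻¹' Metric.closedBall y r ∩ Ico (0 : ℝ) 1 ⊆
        {t ∈ Ico (0 : ℝ) 1 | approx n x t ∈ Metric.closedBall y (2 * r)} := by
      rintro t ⟨ht, ht1⟩
      refine ⟨ht1, ?_⟩
      have h1 := (hγ t ht1).2 n
      rw [mem_preimage, Metric.mem_closedBall] at ht
      rw [Metric.mem_closedBall]
      linarith [dist_triangle (approx n x t) (γ t) y]
    refine (mul_le_mul_left (measure_mono hsub) _).trans
      ((volume_approx_mem_closedBall n x y (2 * r)).trans ?_)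
    have hball : iter rhombus n x ∩ Metric.closedBall y (2 * r + (scale n x)⁻¹) ⊆
        Metric.closedBall y (3 * r) :=
      inter_subset_right.trans (Metric.closedBall_subset_closedBall (by linarith))
    refine (measure_mono hball).trans (le_of_eq ?_)
    rw [Complex.volume_closedBall, ← ENNReal.ofReal_coe_nnreal,
      ← ENNReal.ofReal_pow (by positivity), ← ENNReal.ofReal_mul (by positivity), NNReal.coe_real_pi]
    congr 1
    ring

/-! ### Dimensions for a given growth exponent -/

/-- The number of segments grows like the power `s` of the reciprocal of their length, and the
similarity ratios are bounded. -/
structure HasGrowth (x : ℕ → ℕ) (s : ℝ) : Prop where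
  one_le : ∀ i, 1 ≤ x i
  exists_bound : ∃ M : ℝ, ∀ i, (ell (x i) : ℝ) ≤ M
  nonneg : 0 ≤ s
  lower : ∀ t < s, ∀ᶠ n in atTop, scale n x ^ t ≤ count n x
  upper : ∀ t, s < t → ∀ᶠ n in atTop, count n x ≤ scale n x ^ t

theorem scale_succ_last (n : ℕ) (x : ℕ → ℕ) : scale (n + 1) x = scale n x * ell (x n) :=
  Finset.prod_range_succ _ _

theorem one_le_ell (a : ℕ) : (1 : ℝ) ≤ ell a := by
  rw [ell_cast]
  linarith [(Nat.cast_nonneg a : (0 : ℝ) ≤ a)]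

theorem scale_mono (x : ℕ → ℕ) : Monotone fun n => scale n x :=
  monotone_nat_of_le_succ fun n => by
    rw [scale_succ_last]
    exact le_mul_of_one_le_right (scale_pos n x).le (one_le_ell _)

theorem eventually_const_mul_rpow_le_one (C : ℝ) {δ : ℝ} (hδ : 0 < δ) :
    ∀ᶠ ε in 𝓝[>] (0 : ℝ), C * ε ^ δ ≤ 1 := by
  have h : Tendsto (fun ε : ℝ => C * ε ^ δ) (𝓝[>] 0) (𝓝 (C * 0 ^ δ)) :=
    ((Real.continuousAt_rpow_const 0 δ (Or.inr hδ.le)).tendsto.mono_left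
      nhdsWithin_le_nhds).const_mul C
  rw [Real.zero_rpow hδ.ne', mul_zero] at h
  exact h.eventually_le_const one_pos

/-- Take the first `n` with `1 / scale n x ≤ ε`. By minimality the previous scale is below `1 / ε`,
and one step multiplies it by at most `M`. For small `ε` this `n` is large enough for `p`. -/
theorem eventually_exists_scale {x : ℕ → ℕ} (hx : ∀ i, 1 ≤ x i) {M : ℝ}
    (hM : ∀ i, (ell (x i) : ℝ) ≤ M) {p : ℕ → Prop} (hp : ∀ᶠ n in atTop, p n) :
    ∀ᶠ ε in 𝓝[>] (0 : ℝ), ∃ n, p n ∧ (scale n x)⁻¹ ≤ ε ∧ scale n x ≤ M / ε := by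
  classical
  obtain ⟨n₀, hn₀⟩ := eventually_atTop.1 hp
  have hs₀ := inv_pos.2 (scale_pos n₀ x)
  filter_upwards [Ioo_mem_nhdsGT hs₀, Ioo_mem_nhdsGT one_pos] with ε ⟨hε, hε₀⟩ ⟨_, hε₁⟩
  have hex : ∃ n, (scale n x)⁻¹ ≤ ε := by
    obtain ⟨n, hn⟩ := pow_unbounded_of_one_lt ε⁻¹ (by norm_num : (1 : ℝ) < 3)
    exact ⟨n, inv_le_of_inv_le₀ hε (hn.le.trans (three_pow_le_scale hx n))⟩
  refine ⟨Nat.find hex, hn₀ _ ?_, Nat.find_spec hex, ?_⟩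
  · by_contra! hlt
    have h1 := scale_mono x hlt.le
    have h2 := Nat.find_spec hex
    simp only at h1
    linarith [inv_anti₀ (scale_pos _ x) h1]
  · obtain ⟨k, hk⟩ : ∃ k, Nat.find hex = k + 1 := by
      refine Nat.exists_eq_succ_of_ne_zero fun h0 => ?_
      have h2 := Nat.find_spec hex
      rw [h0, scale_zero, inv_one] at h2
      linarith
    have h3 : ε < (scale k x)⁻¹ := not_le.1 (Nat.find_min hex (by omega))
    have h4 : scale k x < ε⁻¹ := (lt_inv_comm₀ hε (scale_pos k x)).1 h3
    rw [hk, scale_succ_last, div_eq_inv_mul]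
    exact mul_le_mul h4.le (hM k) (ell_pos _).le (inv_pos.2 hε).le

namespace HasGrowth

variable {x : ℕ → ℕ} {s : ℝ}

theorem le_two (h : HasGrowth x s) : s ≤ 2 := by
  by_contra! hs
  obtain ⟨n, hn, hn1⟩ := ((h.lower 2 hs).and (eventually_ge_atTop 1)).exists
  have h1 := count_div_scale_sq_le h.one_le n
  have h2 : (4 / 9 : ℝ) ^ n < 1 := pow_lt_one₀ (by norm_num) (by norm_num) (by omega)
  rw [div_le_iff₀ (pow_pos (scale_pos n x) 2)] at h1
  rw [Real.rpow_two] at hn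
  nlinarith [pow_pos (scale_pos n x) 2]

/-- An exponent `u` between `s` and `t` leaves a factor `ε ^ (t - u)`, which absorbs `C` and the
bound on the ratios. The lower bound below uses the same device. -/
theorem eventually_upper (h : HasGrowth x s) {t : ℝ} (ht : s < t) {C : ℝ} (hC : 0 ≤ C) :
    ∀ᶠ ε in 𝓝[>] (0 : ℝ), ∃ n, (scale n x)⁻¹ ≤ ε ∧ C * count n x ≤ ε ^ (-t) := by
  obtain ⟨M, hM⟩ := h.exists_bound
  obtain ⟨u, hu, hut⟩ := exists_between ht
  have hM0 : 0 ≤ M := (ell_pos _).le.trans (hM 0)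
  filter_upwards [eventually_exists_scale h.one_le hM (h.upper u hu), self_mem_nhdsWithin,
    eventually_const_mul_rpow_le_one (C * M ^ u) (sub_pos.2 hut)] with ε ⟨n, h1, h2, h3⟩ hε h4
  have hε : 0 < ε := hε
  refine ⟨n, h2, ?_⟩
  have hu0 : 0 ≤ u := h.nonneg.trans hu.le
  have h5 : scale n x ^ u ≤ M ^ u * ε ^ (-u) := by
    refine (Real.rpow_le_rpow (scale_pos n x).le h3 hu0).trans (le_of_eq ?_)
    rw [Real.div_rpow hM0 hε.le, Real.rpow_neg hε.le, div_eq_mul_inv]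
  calc C * count n x ≤ C * (M ^ u * ε ^ (-u)) := mul_le_mul_of_nonneg_left (h1.trans h5) hC
    _ = C * M ^ u * ε ^ (t - u) * ε ^ (-t) := by
        rw [mul_assoc (C * M ^ u), ← Real.rpow_add hε]
        ring_nf
    _ ≤ 1 * ε ^ (-t) := mul_le_mul_of_nonneg_right h4 (Real.rpow_nonneg hε.le _)
    _ = ε ^ (-t) := one_mul _

theorem eventually_lower (h : HasGrowth x s) {t : ℝ} (ht : t < s) (C : ℝ) :
    ∀ᶠ ε in 𝓝[>] (0 : ℝ), ∃ n, (scale n x)⁻¹ ≤ ε ∧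
      C * ε ^ (2 - t) ≤ count n x / scale n x ^ 2 := by
  obtain ⟨M, hM⟩ := h.exists_bound
  obtain ⟨u, htu, hu⟩ := exists_between ht
  have hM0 : 0 < M := (ell_pos _).trans_le (hM 0)
  filter_upwards [eventually_exists_scale h.one_le hM (h.lower u hu), self_mem_nhdsWithin,
    eventually_const_mul_rpow_le_one (C * M ^ (2 - u)) (sub_pos.2 htu)] with ε ⟨n, h1, h2, h3⟩ hε h4
  have hε : 0 < ε := hε
  refine ⟨n, h2, ?_⟩
  have hs := scale_pos n x
  have hu0 : u - 2 ≤ 0 := by linarith [h.le_two]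
  have h5 : M ^ (u - 2) * ε ^ (2 - u) ≤ scale n x ^ (u - 2) := by
    refine le_trans (le_of_eq ?_) (Real.rpow_le_rpow_of_nonpos hs h3 hu0)
    rw [Real.div_rpow hM0.le hε.le, div_eq_mul_inv, ← Real.rpow_neg hε.le, neg_sub]
  calc C * ε ^ (2 - t) = C * M ^ (2 - u) * ε ^ (u - t) * (M ^ (u - 2) * ε ^ (2 - u)) := by
        have e1 : M ^ (2 - u) * M ^ (u - 2) = 1 := by
          rw [← Real.rpow_add hM0, show 2 - u + (u - 2) = 0 by ring, Real.rpow_zero]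
        have e2 : ε ^ (u - t) * ε ^ (2 - u) = ε ^ (2 - t) := by
          rw [← Real.rpow_add hε]; ring_nf
        rw [← e2]
        linear_combination (-C * ε ^ (u - t) * ε ^ (2 - u)) * e1
    _ ≤ 1 * (M ^ (u - 2) * ε ^ (2 - u)) := mul_le_mul_of_nonneg_right h4
        (mul_nonneg (Real.rpow_nonneg hM0.le _) (Real.rpow_nonneg hε.le _))
    _ ≤ scale n x ^ (u - 2) := by rwa [one_mul]
    _ = scale n x ^ u / scale n x ^ 2 := by rw [Real.rpow_sub hs, Real.rpow_two]
    _ ≤ count n x / scale n x ^ 2 := by gcongr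

theorem eventually_volume_cthickening_le (h : HasGrowth x s) {K : Set ℂ} (hK : K ⊆ closedCurve x)
    {t : ℝ} (ht : s < t) :
    ∀ᶠ ε in 𝓝[>] (0 : ℝ), volume (Metric.cthickening ε K) ≤ ENNReal.ofReal (ε ^ (2 - t)) := by
  filter_upwards [h.eventually_upper ht (C := 27 * Real.pi) (by positivity), self_mem_nhdsWithin]
    with ε ⟨n, h1, h2⟩ hε
  have hε : 0 < ε := hε
  refine (volume_cthickening_le hK hε h1).trans (ENNReal.ofReal_le_ofReal ?_)
  have e : ε ^ (2 - t) = ε ^ (-t) * ε ^ 2 := by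
    rw [← Real.rpow_two, ← Real.rpow_add hε]; ring_nf
  rw [e]
  exact mul_le_mul_of_nonneg_right h2 (by positivity)

theorem eventually_le_innerVol (h : HasGrowth x s) {t : ℝ} (ht : t < s) :
    ∀ᶠ ε in 𝓝[>] (0 : ℝ), ENNReal.ofReal (ε ^ (2 - t)) ≤ innerVol (domain x) ε := by
  have hpos : 0 < volume lowerRhombus := isOpen_lowerRhombus.measure_pos _ lowerRhombus_nonempty
  have hfin : volume lowerRhombus ≠ ⊤ :=
    ((measure_mono lowerRhombus_subset_closedBall).trans_lt measure_closedBall_lt_top).ne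
  have hr := ENNReal.toReal_pos hpos.ne' hfin
  filter_upwards [h.eventually_lower ht (volume lowerRhombus).toReal⁻¹, self_mem_nhdsWithin]
    with ε ⟨n, h1, h2⟩ hε
  refine le_trans ?_ (le_innerVol h.one_le h1)
  rw [← ENNReal.ofReal_toReal hfin, ← ENNReal.ofReal_mul (by have := count_pos n x; positivity)]
  refine ENNReal.ofReal_le_ofReal ?_
  rwa [inv_mul_eq_div, div_le_iff₀ hr] at h2

theorem dimH_le (h : HasGrowth x s) {K : Set ℂ} (hK : K ⊆ closedCurve x) :
    dimH K ≤ ENNReal.ofReal s := by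
  refine ENNReal.le_of_forall_pos_le_add fun δ hδ _ => ?_
  have e : ENNReal.ofReal s + δ = ((s.toNNReal + δ : NNReal) : ENNReal) := by
    rw [ENNReal.coe_add]; rfl
  rw [e]
  refine (dimH_mono hK).trans (dimH_le_of_hausdorffMeasure_ne_top ?_)
  have hst : s < ((s.toNNReal + δ : NNReal) : ℝ) := by
    rw [NNReal.coe_add, Real.coe_toNNReal _ h.nonneg]
    linarith [NNReal.coe_pos.2 hδ]
  have ht0 : (0 : ℝ) ≤ ((s.toNNReal + δ : NNReal) : ℝ) := NNReal.coe_nonneg _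
  generalize ((s.toNNReal + δ : NNReal) : ℝ) = t at hst ht0
  choose F hF hcov using fun n => exists_cover_closedCurve n x
  have hdiam : ∀ n (c : ℂ), Metric.ediam (Metric.closedBall c (scale n x)⁻¹) ≤
      ENNReal.ofReal (2 * (scale n x)⁻¹) := fun n c =>
    Metric.ediam_le_of_forall_dist_le fun y hy z hz => by
      rw [Metric.mem_closedBall] at hy hz
      linarith [dist_triangle_right y z c]
  have hr : Tendsto (fun n => ENNReal.ofReal (2 * (scale n x)⁻¹)) atTop (𝓝 0) := by
    rw [← ENNReal.ofReal_zero]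
    refine ENNReal.tendsto_ofReal ?_
    have h3 : Tendsto (fun n : ℕ => 2 * ((1 / 3 : ℝ)) ^ n) atTop (𝓝 (2 * 0)) :=
      (tendsto_pow_atTop_nhds_zero_of_lt_one (by norm_num) (by norm_num)).const_mul 2
    rw [mul_zero] at h3
    refine squeeze_zero (fun n => by have := scale_pos n x; positivity) (fun n => ?_) h3
    rw [one_div, inv_pow]
    exact mul_le_mul_of_nonneg_left (inv_anti₀ (by positivity) (three_pow_le_scale h.one_le n))
      (by norm_num)
  -- The sums for these covers are at most `3 * count * (2 / scale) ^ t`, hence eventually at most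
  -- `3 * 2 ^ t`, as `t` exceeds the growth exponent.
  have hle := Measure.hausdorffMeasure_le_liminf_sum t (closedCurve x)
    (fun n => ENNReal.ofReal (2 * (scale n x)⁻¹)) hr
    (fun n (c : F n) => Metric.closedBall (c : ℂ) (scale n x)⁻¹)
    (Eventually.of_forall fun n c => hdiam n c)
    (Eventually.of_forall fun n => by
      rw [iUnion_subtype]
      exact hcov n)
  refine (hle.trans_lt (lt_of_le_of_lt ?_ (ENNReal.ofReal_lt_top (r := 3 * 2 ^ t)))).ne
  refine liminf_le_of_frequently_le' (Eventually.frequently ?_)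
  filter_upwards [h.upper t hst] with n hn
  have hs := scale_pos n x
  refine (Finset.sum_le_card_nsmul Finset.univ
    (fun c : F n => Metric.ediam (Metric.closedBall (c : ℂ) (scale n x)⁻¹) ^ t)
    (ENNReal.ofReal (2 * (scale n x)⁻¹) ^ t) fun c _ =>
      ENNReal.rpow_le_rpow (hdiam n c) ht0).trans ?_
  rw [Finset.card_univ, Fintype.card_coe, nsmul_eq_mul,
    ENNReal.ofReal_rpow_of_nonneg (by positivity) ht0, ← ENNReal.ofReal_natCast,
    ← ENNReal.ofReal_mul (by positivity)]
  refine ENNReal.ofReal_le_ofReal ?_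
  rw [Real.mul_rpow (by norm_num) (by positivity), Real.inv_rpow hs.le]
  have h6 : ((F n).card : ℝ) ≤ 3 * scale n x ^ t := (hF n).trans (by linarith)
  calc ((F n).card : ℝ) * (2 ^ t * (scale n x ^ t)⁻¹)
      ≤ 3 * scale n x ^ t * (2 ^ t * (scale n x ^ t)⁻¹) :=
        mul_le_mul_of_nonneg_right h6 (by positivity)
    _ = 3 * 2 ^ t := by
        have := (Real.rpow_pos_of_pos hs t).ne'
        field_simp

/-- Mass distribution principle: for `t < u < s` small balls have mass at most `r ^ u`, so the
measure is dominated by the `u`-dimensional Hausdorff measure, which is then positive on the curve,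
and the `t`-dimensional one is infinite. -/
theorem le_dimH_curve (h : HasGrowth x s) : ENNReal.ofReal s ≤ dimH (curve x) := by
  refine le_of_forall_lt fun c hc => ?_
  obtain ⟨t, hct, hts⟩ := ENNReal.lt_iff_exists_nnreal_btwn.1 hc
  refine hct.trans_le (le_dimH_of_hausdorffMeasure_ne_zero ?_)
  have hts' : (t : ℝ) < s := by
    rw [← ENNReal.ofReal_coe_nnreal] at hts
    exact (ENNReal.ofReal_lt_ofReal_iff_of_nonneg t.2).1 hts
  obtain ⟨u, htu, hus⟩ := exists_between hts'
  have hu0 : 0 < u := t.2.trans_lt htu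
  obtain ⟨μ, hμ, hball⟩ := exists_measure h.one_le
  have hpos : 0 < volume rhombus := isOpen_rhombus.measure_pos _
    (lowerRhombus_nonempty.mono lowerRhombus_subset_rhombus)
  have hfin : volume rhombus ≠ ⊤ :=
    ((measure_mono rhombus_subset).trans_lt volume_closedRhombus_lt_top).ne
  have hr := ENNReal.toReal_pos hpos.ne' hfin
  have hb : ∀ᶠ r in 𝓝[>] (0 : ℝ), ∀ y, μ (Metric.closedBall y r) ≤ ENNReal.ofReal (r ^ u) := by
    filter_upwards [h.eventually_lower hus
      (9 * Real.pi / (volume rhombus).toReal), self_mem_nhdsWithin]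
      with r ⟨n, h1, h2⟩ hr0 y
    have hr0 : 0 < r := hr0
    have hq : 0 < ENNReal.ofReal (count n x / scale n x ^ 2) * volume rhombus :=
      ENNReal.mul_pos (ENNReal.ofReal_pos.2 (div_pos (count_pos n x)
        (pow_pos (scale_pos n x) 2))).ne' hpos.ne'
    rw [← ENNReal.mul_le_mul_iff_left hq.ne' (ENNReal.mul_ne_top ENNReal.ofReal_ne_top hfin)]
    refine (hball n y r h1).trans ?_
    rw [← ENNReal.ofReal_toReal hfin, ← ENNReal.ofReal_mul (by have := count_pos n x; positivity),
      ← ENNReal.ofReal_mul (by positivity)]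
    refine ENNReal.ofReal_le_ofReal ?_
    have e : r ^ u * r ^ (2 - u) = r ^ 2 := by
      rw [← Real.rpow_add hr0, ← Real.rpow_two]; ring_nf
    calc 9 * Real.pi * r ^ 2 = r ^ u * (9 * Real.pi / (volume rhombus).toReal * r ^ (2 - u) *
          (volume rhombus).toReal) := by
          rw [← e]
          field_simp
      _ ≤ _ := by gcongr
  obtain ⟨ρ, hρ, hρb⟩ := mem_nhdsGT_iff_exists_Ioo_subset.1 hb
  have hρ : 0 < ρ := hρ
  have hle : μ ≤ Measure.hausdorffMeasure u := by
    refine Measure.le_hausdorffMeasure u μ (ENNReal.ofReal (ρ / 2)) (by simpa using hρ)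
      fun S hS => ?_
    rcases S.eq_empty_or_nonempty with rfl | ⟨y, hy⟩
    · simp
    have hne : Metric.ediam S ≠ ⊤ := (hS.trans_lt ENNReal.ofReal_lt_top).ne
    have hd : (Metric.ediam S).toReal ≤ ρ / 2 := ENNReal.toReal_le_of_le_ofReal (by positivity) hS
    have hsub : ∀ r, (Metric.ediam S).toReal ≤ r → S ⊆ Metric.closedBall y r := fun r hr z hz => by
      rw [Metric.mem_closedBall, dist_edist]
      exact (ENNReal.toReal_mono hne (Metric.edist_le_ediam_of_mem hz hy)).trans hr
    -- The ball estimate needs `r > 0`, while the diameter of `S` may be zero; hence the limit as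
    -- `r` decreases to the diameter.
    have hlim : Tendsto (fun r : ℝ => ENNReal.ofReal (r ^ u)) (𝓝[>] (Metric.ediam S).toReal)
        (𝓝 (ENNReal.ofReal ((Metric.ediam S).toReal ^ u))) :=
      ENNReal.tendsto_ofReal
        ((Real.continuousAt_rpow_const _ u (Or.inr hu0.le)).tendsto.mono_left nhdsWithin_le_nhds)
    have hconv : ENNReal.ofReal ((Metric.ediam S).toReal ^ u) = Metric.ediam S ^ u := by
      rw [← ENNReal.ofReal_rpow_of_nonneg ENNReal.toReal_nonneg hu0.le, ENNReal.ofReal_toReal hne]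
    rw [← hconv]
    refine ge_of_tendsto hlim ?_
    filter_upwards [Ioo_mem_nhdsGT (show (Metric.ediam S).toReal < ρ by linarith)] with r hr
    exact (measure_mono (hsub r hr.1.le)).trans
      (hρb ⟨ENNReal.toReal_nonneg.trans_lt hr.1, hr.2⟩ y)
  have h1 : Measure.hausdorffMeasure u (curve x) ≠ 0 := by
    refine (lt_of_lt_of_le ?_ (hle _)).ne'
    rw [hμ]
    exact one_pos
  rcases Measure.hausdorffMeasure_zero_or_top htu (curve x) with h0 | h0
  · exact absurd h0 h1
  · rw [h0]; simp

end HasGrowth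

/-! ### Minkowski dimensions -/

/-- Dividing by `log ε < 0` reverses inequalities: upper bounds on `V` bound the ratio from below,
and lower bounds bound it from above. -/
theorem tendsto_logRatio {V : ℝ → ENNReal} {s : ℝ}
    (hup : ∀ t, s < t → ∀ᶠ ε in 𝓝[>] (0 : ℝ), V ε ≤ ENNReal.ofReal (ε ^ (2 - t)))
    (hlow : ∀ t < s, ∀ᶠ ε in 𝓝[>] (0 : ℝ), ENNReal.ofReal (ε ^ (2 - t)) ≤ V ε) :
    Tendsto (logRatio V) (𝓝[>] 0) (𝓝 ((2 - s : ℝ) : EReal)) := by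
  have hlog : ∀ {ε t : ℝ}, 0 < ε →
      ENNReal.log (ENNReal.ofReal (ε ^ t)) = ((t * Real.log ε : ℝ) : EReal) := by
    intro ε t hε
    rw [ENNReal.log_ofReal_of_pos (Real.rpow_pos_of_pos hε t), Real.log_rpow hε]
  have hquot : ∀ {ε t : ℝ}, Real.log ε < 0 →
      ((t * Real.log ε : ℝ) : EReal) / ((Real.log ε : ℝ) : EReal) = (t : EReal) := by
    intro ε t hε
    rw [← EReal.coe_div, mul_div_cancel_right₀ _ hε.ne]
  rw [tendsto_order]
  constructor
  · intro a ha
    obtain ⟨b, hab, hb⟩ := EReal.lt_iff_exists_real_btwn.1 ha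
    have hb' : b < 2 - s := EReal.coe_lt_coe_iff.1 hb
    filter_upwards [hup (2 - b) (by linarith), Ioo_mem_nhdsGT one_pos] with ε h1 ⟨h0, h2⟩
    have hneg := Real.log_neg h0 h2
    refine hab.trans_le ?_
    rw [logRatio, ← hquot (t := b) hneg]
    refine EReal.div_le_div_right_of_nonpos (by exact_mod_cast hneg.le) ?_
    rw [← hlog h0]
    rw [sub_sub_cancel] at h1
    exact ENNReal.log_monotone h1
  · intro a ha
    obtain ⟨b, hb, hab⟩ := EReal.lt_iff_exists_real_btwn.1 ha
    have hb' : 2 - s < b := EReal.coe_lt_coe_iff.1 hb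
    filter_upwards [hlow (2 - b) (by linarith), Ioo_mem_nhdsGT one_pos] with ε h1 ⟨h0, h2⟩
    have hneg := Real.log_neg h0 h2
    refine lt_of_le_of_lt ?_ hab
    rw [logRatio, ← hquot (t := b) hneg]
    refine EReal.div_le_div_right_of_nonpos (by exact_mod_cast hneg.le) ?_
    rw [← hlog h0]
    rw [sub_sub_cancel] at h1
    exact ENNReal.log_monotone h1

theorem dims_eq_of_tendsto {V : ℝ → ENNReal} {s : ℝ}
    (h : Tendsto (logRatio V) (𝓝[>] 0) (𝓝 ((2 - s : ℝ) : EReal))) :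
    lowerDim V = (s : EReal) ∧ upperDim V = (s : EReal) := by
  have e : (2 : EReal) - ((2 - s : ℝ) : EReal) = (s : EReal) := by
    change ((2 : ℝ) : EReal) - ((2 - s : ℝ) : EReal) = (s : EReal)
    rw [← EReal.coe_sub, sub_sub_cancel]
  rw [lowerDim, upperDim, h.limsup_eq, h.liminf_eq]
  exact ⟨e, e⟩

namespace HasGrowth

variable {x : ℕ → ℕ} {s : ℝ}

theorem hasInnerMinkowskiDim (h : HasGrowth x s) : HasInnerMinkowskiDim (domain x) s := by
  refine dims_eq_of_tendsto (tendsto_logRatio (fun t ht => ?_) fun t ht =>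
    h.eventually_le_innerVol ht)
  filter_upwards [h.eventually_volume_cthickening_le (frontier_domain_subset x) ht] with ε hε
  exact (measure_mono inter_subset_left).trans hε

theorem hasMinkowskiDim (h : HasGrowth x s) : HasMinkowskiDim (frontier (domain x)) s := by
  refine dims_eq_of_tendsto (tendsto_logRatio (fun t ht =>
    h.eventually_volume_cthickening_le (frontier_domain_subset x) ht) fun t ht => ?_)
  filter_upwards [h.eventually_le_innerVol ht] with ε hε
  exact hε.trans (measure_mono inter_subset_left)

theorem dimH_frontier (h : HasGrowth x s) : dimH (frontier (domain x)) = ENNReal.ofReal s :=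
  le_antisymm (h.dimH_le (frontier_domain_subset x))
    (h.le_dimH_curve.trans (dimH_mono (curve_subset_frontier_domain h.one_le)))

end HasGrowth

/-! ### Frequencies determine the growth -/

theorem tendsto_average {A : Finset ℕ} {p : ℕ → ℝ} {x : ℕ → ℕ} (hx : ∀ i, x i ∈ A)
    (hf : ∀ a ∈ A, Tendsto (freq x a) atTop (𝓝 (p a))) (g : ℕ → ℝ) :
    Tendsto (fun n : ℕ => 1 / (n : ℝ) * ∑ i ∈ Finset.range n, g (x i)) atTop
      (𝓝 (∑ a ∈ A, p a * g a)) := by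
  refine (tendsto_finsetSum A fun a ha => (hf a ha).mul_const (g a)).congr fun n => ?_
  simp only [freq, mul_assoc, ← Finset.mul_sum, Finset.sum_mul]
  rw [Finset.sum_comm]
  congr 1
  refine Finset.sum_congr rfl fun i _ => ?_
  simp [hx i]

theorem log_count (n : ℕ) (x : ℕ → ℕ) :
    Real.log (count n x) = ∑ i ∈ Finset.range n, Real.log (m (x i)) :=
  Real.log_prod fun i _ => by exact_mod_cast (m_pos (x i)).ne'

theorem log_scale (n : ℕ) (x : ℕ → ℕ) :
    Real.log (scale n x) = ∑ i ∈ Finset.range n, Real.log (ell (x i)) :=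
  Real.log_prod fun i _ => (ell_pos (x i)).ne'

/-- `log count / n` and `log scale / n` converge to the numerator and the denominator of `dimValue A
p`; the latter is at least `log 3`. Comparing `log count` with `t * log scale` gives both growth
bounds. -/
theorem hasGrowth_of_freq {A : Finset ℕ} (hA : ∀ a ∈ A, 1 ≤ a) {p : ℕ → ℝ} (hp : ∀ a ∈ A, 0 ≤ p a)
    (hp1 : ∑ a ∈ A, p a = 1) {x : ℕ → ℕ} (hx : ∀ i, x i ∈ A)
    (hf : ∀ a ∈ A, Tendsto (freq x a) atTop (𝓝 (p a))) : HasGrowth x (dimValue A p) := by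
  have hN := tendsto_average hx hf fun a => Real.log (m a)
  have hL := tendsto_average hx hf fun a => Real.log (ell a)
  simp only [← log_count, ← log_scale] at hN hL
  have hden : 0 < ∑ a ∈ A, p a * Real.log (ell a) := by
    have h3 : (0 : ℝ) < Real.log 3 := Real.log_pos (by norm_num)
    refine lt_of_lt_of_le h3 ?_
    rw [← one_mul (Real.log 3), ← hp1, Finset.sum_mul]
    exact Finset.sum_le_sum fun a ha => mul_le_mul_of_nonneg_left
      (Real.log_le_log (by norm_num) (three_le_ell (hA a ha))) (hp a ha)
  have hnum : 0 ≤ ∑ a ∈ A, p a * Real.log (m a) :=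
    Finset.sum_nonneg fun a ha => mul_nonneg (hp a ha) (Real.log_natCast_nonneg _)
  refine ⟨fun i => hA _ (hx i), ⟨∑ a ∈ A, (ell a : ℝ), fun i =>
    Finset.single_le_sum (f := fun a => (ell a : ℝ)) (fun a _ => (ell_pos a).le) (hx i)⟩,
    div_nonneg hnum hden.le, fun t ht => ?_, fun t ht => ?_⟩
  · rw [dimValue, lt_div_iff₀ hden] at ht
    filter_upwards [(hL.const_mul t).eventually_lt hN ht, eventually_gt_atTop 0] with n h1 hn
    have hn' : (0 : ℝ) < 1 / n := by positivity
    have h2 : t * Real.log (scale n x) < Real.log (count n x) := by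
      rw [mul_left_comm] at h1
      exact lt_of_mul_lt_mul_left h1 hn'.le
    rw [← Real.log_rpow (scale_pos n x)] at h2
    exact ((Real.log_lt_log_iff (Real.rpow_pos_of_pos (scale_pos n x) t) (count_pos n x)).1 h2).le
  · rw [dimValue, div_lt_iff₀ hden] at ht
    filter_upwards [hN.eventually_lt (hL.const_mul t) ht, eventually_gt_atTop 0] with n h1 hn
    have hn' : (0 : ℝ) < 1 / n := by positivity
    have h2 : Real.log (count n x) < t * Real.log (scale n x) := by
      rw [mul_left_comm] at h1
      exact lt_of_mul_lt_mul_left h1 hn'.le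
    rw [← Real.log_rpow (scale_pos n x)] at h2
    exact ((Real.log_lt_log_iff (count_pos n x) (Real.rpow_pos_of_pos (scale_pos n x) t)).1 h2).le

end Snowflake

end

/-! ### The main theorem -/

theorem mainTheorem8 {Ω : Type*} [MeasurableSpace Ω] (P : Measure Ω) [IsProbabilityMeasure P]
    (A : Finset ℕ) (hA : ∀ a ∈ A, 1 ≤ a)
    (ξ : ℕ → Ω → ℕ) (hmeas : ∀ n, Measurable (ξ n)) (hval : ∀ n ω, ξ n ω ∈ A)
    (herg : Snowflake.StationaryErgodic P ξ) :
    ∃ p : ℕ → ℝ, (∀ a ∈ A, 0 ≤ p a) ∧ ∑ a ∈ A, p a = 1 ∧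
      ∀ᵐ ω ∂P,
        (∀ a ∈ A, Tendsto (Snowflake.freq (fun n => ξ n ω) a) atTop (𝓝 (p a))) ∧
        Snowflake.HasInnerMinkowskiDim (Snowflake.domain (fun n => ξ n ω))
          (Snowflake.dimValue A p) ∧
        Snowflake.HasMinkowskiDim (frontier (Snowflake.domain (fun n => ξ n ω)))
          (Snowflake.dimValue A p) ∧
        dimH (frontier (Snowflake.domain (fun n => ξ n ω))) =
          ENNReal.ofReal (Snowflake.dimValue A p) := by
  have hp : ∀ a ∈ A, 0 ≤ P.real {ω | ξ 0 ω = a} := fun a _ => measureReal_nonneg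
  have hp1 : ∑ a ∈ A, P.real {ω | ξ 0 ω = a} = 1 := by
    have h := sum_measureReal_preimage_singleton (μ := P) A (f := ξ 0)
      fun a _ => hmeas 0 (measurableSet_singleton a)
    have h2 : ξ 0 ⁻¹' (A : Set ℕ) = univ := eq_univ_of_forall fun ω => hval 0 ω
    rw [h2, probReal_univ] at h
    exact h
  refine ⟨fun a => P.real {ω | ξ 0 ω = a}, hp, hp1, ?_⟩
  -- The only exceptional null set is the one where some frequency fails to converge; all dimensions
  -- follow pointwise.
  filter_upwards [ae_all_iff.2 fun a => Snowflake.ae_tendsto_freq hmeas herg a] with ω hω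
  have h := Snowflake.hasGrowth_of_freq hA hp hp1 (fun i => hval i ω) fun a _ => hω a
  exact ⟨fun a _ => hω a, h.hasInnerMinkowskiDim, h.hasMinkowskiDim, h.dimH_frontier⟩
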